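/- A PROP is a strict symmetric monoidal category whose monoid of objects is $(\mathbb{N},+,0)$; a morphism of PROPs is an identity-on-objects strict symmetric monoidal functor, and an isomorphism of PROPs is an invertible such morphism. Write $\underline{n}=\{1,\dots,n\}$. Let $\mathsf{Syn}(\delta)$ be the PROP whose morphisms $m\to n$ are isomorphism classes of finite directed acyclic graphs with $m$ linearly ordered input half-edges, $n$ linearly ordered output half-edges, and finitely many internal vertices, each with exactly one incoming half-edge and an ordered pair (left, right) of outgoing half-edges, in which every input half-edge and every outgoing half-edge of a vertex is joined by a wire to exactly one output half-edge or incoming half-edge of a vertex, and conversely. Isomorphisms are bijections of the internal vertices that preserve all wires with their positions at the inputs, outputs and vertices. Composition is gluing of outputs to inputs in order, tensor is disjoint union with concatenated boundaries, and identities and symmetries are the corresponding vertex-free graphs. (This is the graphical model of the free PROP on one generator $\delta:1\to 2$; the generator $\delta$ is the graph with exactly one vertex, whose incoming half-edge is joined to the input and whose left and right outgoing half-edges are joined to the first and second output.) Let $\mathbf{FinCorel}$ be the PROP whose morphisms $m\to n$ are the equivalence relations on $\underline{m}\sqcup\underline{n}$; the composite of $R:m\to n$ and $S:n\to p$ is the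 restriction to $\underline{m}\sqcup\underline{p}$ of the transitive closure of $R\cup S$ on $\underline{m}\sqcup\underline{n}\sqcup\underline{p}$, tensor is disjoint union with reindexing, and identities and symmetries are the equivalence relations matching each input with the corresponding output. For $f:m\to n$ in $\mathsf{Syn}(\delta)$, let $\Pi(f)$ be the equivalence relation on $\underline{m}\sqcup\underline{n}$ for which two boundary elements are equivalent if and only if they lie in the same connected component of the underlying undirected graph of $f$ (with inputs and outputs attached as pendant vertices). Let $\mathbf{Cocom}$ be the PROP freely generated by one morphism $\delta:1\to 2$ subject to $(\delta+\mathrm{id}_1)\circ\delta=(\mathrm{id}_1+\delta)\circ\delta$ and $\sigma_{1,1}\circ\delta=\delta$, where $\sigma_{1,1}:2\to 2$ is the symmetry. Theorem. (1) $\Pi$ is well defined on isomorphism classes and is an identity-on-objects strict symmetric monoidal functor $\mathsf{Syn}(\delta)\to\mathbf{FinCorel}$. (2) The equivalence relations $R:m\to n$ such that (a) every class of $R$ contains exactly one element of $\underline{m}$ and (b) every class of $R$ contains at least one element of $\underline{n}$ form a sub-PROP $\mathbf{FinCorel}^\circ$ of $\mathbf{FinCorel}$, and $\mathbf{FinCorel}^\circ$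 is the image of $\Pi$. (3) Let $\mathsf{AncQ}=\mathsf{Syn}(\delta)/\ker\Pi$, the PROP obtained by identifying $f$ and $g$ whenever $\Pi(f)=\Pi(g)$. The assignment $[f]\mapsto\Pi(f)$ is an isomorphism of PROPs $\mathsf{AncQ}\cong\mathbf{FinCorel}^\circ$. (4) There is an isomorphism of PROPs $\mathbf{Cocom}\cong\mathsf{AncQ}$ sending $\delta$ to the class $[\delta]$. (5) $\mathbf{Cocom}$ is isomorphic to the PROP whose morphisms $m\to n$ are the surjections $\underline{n}\to\underline{m}$, with composition of functions and disjoint union as tensor, by an isomorphism sending $\delta$ to the unique surjection $\underline{2}\to\underline{1}$. -/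

import Mathlib

universe u v

namespace AncestryPROP

open Sum

/-! ### PROPs -/

/-- Transport of an element of a family indexed by two natural numbers along equalities. -/
def castHom {H : ℕ → ℕ → Type u} {m m' n n' : ℕ} (hm : m = m') (hn : n = n') (f : H m n) :
    H m' n' :=
  hn ▸ hm ▸ f

/-- A PROP: a strict symmetric monoidal category with object monoid `(ℕ, +, 0)`.
Composition is written in diagrammatic order, so `comp f g` is the composite `g ∘ f`.
The transports `castHom` only express the strict equalities `(a + b) + c = a + (b + c)` and
`0 + a = a = a + 0` between objects. -/
structure PROP : Type (u + 1) where
  Hom : ℕ → ℕ → Type u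
  id (n : ℕ) : Hom n n
  comp {m n p : ℕ} : Hom m n → Hom n p → Hom m p
  tensor {m n m' n' : ℕ} : Hom m n → Hom m' n' → Hom (m + m') (n + n')
  symm (m n : ℕ) : Hom (m + n) (n + m)
  id_comp {m n : ℕ} (f : Hom m n) : comp (id m) f = f
  comp_id {m n : ℕ} (f : Hom m n) : comp f (id n) = f
  comp_assoc {m n p q : ℕ} (f : Hom m n) (g : Hom n p) (h : Hom p q) :
    comp (comp f g) h = comp f (comp g h)
  tensor_id (m n : ℕ) : tensor (id m) (id n) = id (m + n)
  tensor_comp {m n p m' n' p' : ℕ} (f : Hom m n) (g : Hom n p) (f' : Hom m' n')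
    (g' : Hom n' p') :
    tensor (comp f g) (comp f' g') = comp (tensor f f') (tensor g g')
  tensor_assoc {m n m' n' m'' n'' : ℕ} (f : Hom m n) (g : Hom m' n') (h : Hom m'' n'') :
    castHom (Nat.add_assoc m m' m'') (Nat.add_assoc n n' n'') (tensor (tensor f g) h) =
      tensor f (tensor g h)
  zero_tensor {m n : ℕ} (f : Hom m n) :
    castHom (Nat.zero_add m) (Nat.zero_add n) (tensor (id 0) f) = f
  tensor_zero {m n : ℕ} (f : Hom m n) :
    castHom (Nat.add_zero m) (Nat.add_zero n) (tensor f (id 0)) = f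
  symm_natural {m n m' n' : ℕ} (f : Hom m n) (g : Hom m' n') :
    comp (tensor f g) (symm n n') = comp (symm m m') (tensor g f)
  symm_symm (m n : ℕ) : comp (symm m n) (symm n m) = id (m + n)
  symm_hexagon (m n p : ℕ) :
    castHom (Nat.add_assoc m n p).symm (Nat.add_assoc n p m) (symm m (n + p)) =
      comp (castHom rfl (Nat.add_assoc n m p) (tensor (symm m n) (id p)))
        (tensor (id n) (symm m p))

/-- A morphism of PROPs: an identity-on-objects strict symmetric monoidal functor. -/
@[ext]
structure PROPHom (P : PROP.{u}) (Q : PROP.{v}) where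
  map {m n : ℕ} : P.Hom m n → Q.Hom m n
  map_id (n : ℕ) : map (P.id n) = Q.id n
  map_comp {m n p : ℕ} (f : P.Hom m n) (g : P.Hom n p) :
    map (P.comp f g) = Q.comp (map f) (map g)
  map_tensor {m n m' n' : ℕ} (f : P.Hom m n) (g : P.Hom m' n') :
    map (P.tensor f g) = Q.tensor (map f) (map g)
  map_symm (m n : ℕ) : map (P.symm m n) = Q.symm m n

/-- An isomorphism of PROPs: two mutually inverse morphisms of PROPs. -/
structure PROPIso (P : PROP.{u}) (Q : PROP.{v}) where
  hom : PROPHom P Q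
  inv : PROPHom Q P
  inv_hom {m n : ℕ} (f : P.Hom m n) : inv.map (hom.map f) = f
  hom_inv {m n : ℕ} (g : Q.Hom m n) : hom.map (inv.map g) = g

theorem castHom_map {H : ℕ → ℕ → Type u} {K : ℕ → ℕ → Type v} (F : ∀ {m n : ℕ}, H m n → K m n)
    {m m' n n' : ℕ} (hm : m = m') (hn : n = n') (f : H m n) :
    F (castHom hm hn f) = castHom hm hn (F f) := by
  subst hm hn; rfl

/-- A sub-PROP: a class of morphisms containing the identities and the symmetries and closed
under composition and tensor. -/
structure SubPROP (P : PROP.{u}) where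
  carrier (m n : ℕ) : Set (P.Hom m n)
  id_mem (n : ℕ) : P.id n ∈ carrier n n
  comp_mem {m n p : ℕ} {f : P.Hom m n} {g : P.Hom n p} :
    f ∈ carrier m n → g ∈ carrier n p → P.comp f g ∈ carrier m p
  tensor_mem {m n m' n' : ℕ} {f : P.Hom m n} {g : P.Hom m' n'} :
    f ∈ carrier m n → g ∈ carrier m' n' → P.tensor f g ∈ carrier (m + m') (n + n')
  symm_mem (m n : ℕ) : P.symm m n ∈ carrier (m + n) (n + m)

/-- A sub-PROP, regarded as a PROP. -/
def SubPROP.toPROP {P : PROP.{u}} (S : SubPROP P) : PROP.{u} where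
  Hom m n := {f : P.Hom m n // f ∈ S.carrier m n}
  id n := ⟨P.id n, S.id_mem n⟩
  comp f g := ⟨P.comp f.1 g.1, S.comp_mem f.2 g.2⟩
  tensor f g := ⟨P.tensor f.1 g.1, S.tensor_mem f.2 g.2⟩
  symm m n := ⟨P.symm m n, S.symm_mem m n⟩
  id_comp f := Subtype.ext (P.id_comp f.1)
  comp_id f := Subtype.ext (P.comp_id f.1)
  comp_assoc f g h := Subtype.ext (P.comp_assoc f.1 g.1 h.1)
  tensor_id m n := Subtype.ext (P.tensor_id m n)
  tensor_comp f g f' g' := Subtype.ext (P.tensor_comp f.1 g.1 f'.1 g'.1)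
  tensor_assoc f g h := Subtype.ext <| by
    rw [castHom_map (H := fun m n => {f : P.Hom m n // f ∈ S.carrier m n}) (K := P.Hom)
      (fun f => f.1)]
    exact P.tensor_assoc f.1 g.1 h.1
  zero_tensor f := Subtype.ext <| by
    rw [castHom_map (H := fun m n => {f : P.Hom m n // f ∈ S.carrier m n}) (K := P.Hom)
      (fun f => f.1)]
    exact P.zero_tensor f.1
  tensor_zero f := Subtype.ext <| by
    rw [castHom_map (H := fun m n => {f : P.Hom m n // f ∈ S.carrier m n}) (K := P.Hom)
      (fun f => f.1)]
    exact P.tensor_zero f.1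
  symm_natural f g := Subtype.ext (P.symm_natural f.1 g.1)
  symm_symm m n := Subtype.ext (P.symm_symm m n)
  symm_hexagon m n p := Subtype.ext <| by
    have e := fun {m n m' n' : ℕ} (hm : m = m') (hn : n = n')
      (f : {f : P.Hom m n // f ∈ S.carrier m n}) =>
      castHom_map (H := fun m n => {f : P.Hom m n // f ∈ S.carrier m n}) (K := P.Hom)
      (fun f => f.1) hm hn f
    refine (e _ _ _).trans ((P.symm_hexagon m n p).trans ?_)
    exact congrArg (fun z => P.comp z (P.tensor (P.id n) (P.symm m p)))
      (e rfl (Nat.add_assoc n m p) ⟨P.tensor (P.symm m n) (P.id p), _⟩).symm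

/-- The quotient `P / ker F` of a PROP by the kernel congruence of a morphism of PROPs:
`f` and `g` become equal iff `F f = F g`. -/
def kerQuot {P : PROP.{u}} {Q : PROP.{v}} (F : PROPHom P Q) : PROP.{u} where
  Hom m n := Quotient (Setoid.ker (F.map : P.Hom m n → Q.Hom m n))
  id n := Quotient.mk _ (P.id n)
  comp f g := Quotient.map₂ P.comp (fun a b h c d k => by
    change F.map _ = F.map _ at *
    rw [F.map_comp, F.map_comp, h, k]) f g
  tensor f g := Quotient.map₂ P.tensor (fun a b h c d k => by
    change F.map _ = F.map _ at *
    rw [F.map_tensor, F.map_tensor, h, k]) f g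
  symm m n := Quotient.mk _ (P.symm m n)
  id_comp f := by
    induction f using Quotient.ind
    exact congrArg (Quotient.mk _) (P.id_comp _)
  comp_id f := by
    induction f using Quotient.ind
    exact congrArg (Quotient.mk _) (P.comp_id _)
  comp_assoc f g h := by
    induction f using Quotient.ind
    induction g using Quotient.ind
    induction h using Quotient.ind
    exact congrArg (Quotient.mk _) (P.comp_assoc _ _ _)
  tensor_id m n := congrArg (Quotient.mk _) (P.tensor_id m n)
  tensor_comp f g f' g' := by
    induction f using Quotient.ind
    induction g using Quotient.ind
    induction f' using Quotient.ind
    induction g' using Quotient.ind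
    exact congrArg (Quotient.mk _) (P.tensor_comp _ _ _ _)
  tensor_assoc f g h := by
    induction f using Quotient.ind
    induction g using Quotient.ind
    induction h using Quotient.ind
    exact (castHom_map (H := P.Hom) (fun {m n} f => Quotient.mk (Setoid.ker
      (F.map : P.Hom m n → Q.Hom m n)) f) _ _ _).symm.trans
      (congrArg (Quotient.mk _) (P.tensor_assoc _ _ _))
  zero_tensor f := by
    induction f using Quotient.ind
    exact (castHom_map (H := P.Hom) (fun {m n} f => Quotient.mk (Setoid.ker
      (F.map : P.Hom m n → Q.Hom m n)) f) _ _ _).symm.trans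
      (congrArg (Quotient.mk _) (P.zero_tensor _))
  tensor_zero f := by
    induction f using Quotient.ind
    exact (castHom_map (H := P.Hom) (fun {m n} f => Quotient.mk (Setoid.ker
      (F.map : P.Hom m n → Q.Hom m n)) f) _ _ _).symm.trans
      (congrArg (Quotient.mk _) (P.tensor_zero _))
  symm_natural f g := by
    induction f using Quotient.ind
    induction g using Quotient.ind
    exact congrArg (Quotient.mk _) (P.symm_natural _ _)
  symm_symm m n := congrArg (Quotient.mk _) (P.symm_symm m n)
  symm_hexagon m n p := by
    have e := fun {m n m' n' : ℕ} (hm : m = m') (hn : n = n') (f : P.Hom m n) =>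
      castHom_map (H := P.Hom) (fun {m n} f => Quotient.mk (Setoid.ker
      (F.map : P.Hom m n → Q.Hom m n)) f) hm hn f
    refine (e _ _ _).symm.trans ((congrArg (Quotient.mk _) (P.symm_hexagon m n p)).trans ?_)
    refine Eq.trans ?_ (congrArg (fun z => Quotient.map₂ P.comp _ z _) (e _ _ _))
    rfl

/-- The quotient projection `P → P / ker F`. -/
def kerQuot.proj {P : PROP.{u}} {Q : PROP.{v}} (F : PROPHom P Q) : PROPHom P (kerQuot F) where
  map f := Quotient.mk _ f
  map_id _ := rfl
  map_comp _ _ := rfl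
  map_tensor _ _ := rfl
  map_symm _ _ := rfl

/-! ### The PROP `Syn(δ)` of diagrams -/

/-- A wiring with `m` inputs, `n` outputs and a set `V` of internal vertices, each having one
incoming half-edge and an ordered pair (`false` = left, `true` = right) of outgoing half-edges.
The half-edges at which a wire starts are the inputs and the outgoing half-edges of vertices; the
half-edges at which a wire ends are the outputs and the incoming half-edges of vertices; a wiring
joins each of the former to exactly one of the latter, and conversely. -/
abbrev Wiring (m n : ℕ) (V : Type) : Type := (Fin m ⊕ V × Bool) ≃ (Fin n ⊕ V)

namespace Wiring

/-- No directed path leads from a vertex to itself. -/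
def Acyclic {m n : ℕ} {V : Type} (g : Wiring m n V) : Prop :=
  ∀ v : V, ¬ Relation.TransGen (fun a b => ∃ s, g (inr (a, s)) = inr b) v v

/-- The bijection `φ` of vertices preserves all wires; inputs and outputs are fixed. -/
def IsIso {m n : ℕ} {V W : Type} (g : Wiring m n V) (h : Wiring m n W) (φ : V ≃ W) : Prop :=
  (∀ i, h (inl i) = Sum.map _root_.id φ (g (inl i))) ∧
    ∀ v s, h (inr (φ v, s)) = Sum.map _root_.id φ (g (inr (v, s)))

/-- The vertex-free wiring given by a bijection from inputs to outputs. -/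
def ofEquiv {m n : ℕ} (e : Fin m ≃ Fin n) : Wiring m n Empty :=
  Equiv.sumCongr e (Equiv.equivOfIsEmpty _ _)

/-- Gluing the outputs of `g` to the inputs of `h`, in order. -/
def comp {m n p : ℕ} {V W : Type} (g : Wiring m n V) (h : Wiring n p W) :
    Wiring m p (V ⊕ W) :=
  calc (Fin m ⊕ (V ⊕ W) × Bool)
    _ ≃ Fin m ⊕ (V × Bool ⊕ W × Bool) :=
        Equiv.sumCongr (Equiv.refl _) (Equiv.sumProdDistrib _ _ _)
    _ ≃ (Fin m ⊕ V × Bool) ⊕ W × Bool := (Equiv.sumAssoc _ _ _).symm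
    _ ≃ (Fin n ⊕ V) ⊕ W × Bool := Equiv.sumCongr g (Equiv.refl _)
    _ ≃ (V ⊕ Fin n) ⊕ W × Bool := Equiv.sumCongr (Equiv.sumComm _ _) (Equiv.refl _)
    _ ≃ V ⊕ (Fin n ⊕ W × Bool) := Equiv.sumAssoc _ _ _
    _ ≃ V ⊕ (Fin p ⊕ W) := Equiv.sumCongr (Equiv.refl _) h
    _ ≃ (V ⊕ Fin p) ⊕ W := (Equiv.sumAssoc _ _ _).symm
    _ ≃ (Fin p ⊕ V) ⊕ W := Equiv.sumCongr (Equiv.sumComm _ _) (Equiv.refl _)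
    _ ≃ Fin p ⊕ (V ⊕ W) := Equiv.sumAssoc _ _ _

/-- Juxtaposition, with concatenated boundaries. -/
def tensor {m n m' n' : ℕ} {V W : Type} (g : Wiring m n V) (h : Wiring m' n' W) :
    Wiring (m + m') (n + n') (V ⊕ W) :=
  calc (Fin (m + m') ⊕ (V ⊕ W) × Bool)
    _ ≃ (Fin m ⊕ Fin m') ⊕ (V × Bool ⊕ W × Bool) :=
        Equiv.sumCongr finSumFinEquiv.symm (Equiv.sumProdDistrib _ _ _)
    _ ≃ (Fin m ⊕ V × Bool) ⊕ (Fin m' ⊕ W × Bool) := Equiv.sumSumSumComm _ _ _ _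
    _ ≃ (Fin n ⊕ V) ⊕ (Fin n' ⊕ W) := Equiv.sumCongr g h
    _ ≃ (Fin n ⊕ Fin n') ⊕ (V ⊕ W) := Equiv.sumSumSumComm _ _ _ _
    _ ≃ Fin (n + n') ⊕ (V ⊕ W) := Equiv.sumCongr finSumFinEquiv (Equiv.refl _)

/-- Continuation in the glued wiring of a wire of the first factor which ends at a given place. -/
def bridge {n p : ℕ} (V : Type) {W : Type} (h : Wiring n p W) :
    Fin n ⊕ V → Fin p ⊕ (V ⊕ W)
  | inl j => Sum.map _root_.id inr (h (inl j))
  | inr v => inr (inl v)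

section

variable {m n p m' n' p' q m'' n'' : ℕ} {U V W U' V' W' : Type}

theorem bridge_inl (h : Wiring n p W) (j : Fin n) :
    bridge V h (inl j) = Sum.map _root_.id inr (h (inl j)) := rfl

theorem bridge_inr (h : Wiring n p W) (v : V) : bridge V h (inr v) = inr (inl v) := rfl

theorem ofEquiv_inl (e : Fin m ≃ Fin n) (i : Fin m) : ofEquiv e (inl i) = inl (e i) := rfl

theorem comp_inl (g : Wiring m n V) (h : Wiring n p W) (i : Fin m) :
    comp g h (inl i) = bridge V h (g (inl i)) := by
  simp only [comp, Trans.trans, Equiv.trans_apply]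
  rcases h₁ : g (inl i) with j | v
  · rcases h' : h (inl j) with k | w <;> simp [bridge, h₁, h']
  · simp [bridge, h₁]

theorem comp_inr_inl (g : Wiring m n V) (h : Wiring n p W) (v : V) (s : Bool) :
    comp g h (inr (inl v, s)) = bridge V h (g (inr (v, s))) := by
  simp only [comp, Trans.trans, Equiv.trans_apply]
  rcases h₁ : g (inr (v, s)) with j | v
  · rcases h' : h (inl j) with k | w <;> simp [bridge, h₁, h']
  · simp [bridge, h₁]

theorem comp_inr_inr (g : Wiring m n V) (h : Wiring n p W) (w : W) (s : Bool) :
    comp g h (inr (inr w, s)) = Sum.map _root_.id inr (h (inr (w, s))) := by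
  simp only [comp, Trans.trans, Equiv.trans_apply]
  rcases h₁ : h (inr (w, s)) with j | v <;> simp [h₁]

theorem tensor_castAdd (g : Wiring m n V) (h : Wiring m' n' W) (i : Fin m) :
    tensor g h (inl (Fin.castAdd m' i)) = Sum.map (Fin.castAdd n') inl (g (inl i)) := by
  simp only [tensor, Trans.trans, Equiv.trans_apply]
  rcases h₁ : g (inl i) with j | v <;> simp [h₁]

theorem tensor_natAdd (g : Wiring m n V) (h : Wiring m' n' W) (i : Fin m') :
    tensor g h (inl (Fin.natAdd m i)) = Sum.map (Fin.natAdd n) inr (h (inl i)) := by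
  simp only [tensor, Trans.trans, Equiv.trans_apply]
  rcases h₁ : h (inl i) with j | v <;> simp [h₁]

theorem tensor_inr_inl (g : Wiring m n V) (h : Wiring m' n' W) (v : V) (s : Bool) :
    tensor g h (inr (inl v, s)) = Sum.map (Fin.castAdd n') inl (g (inr (v, s))) := by
  simp only [tensor, Trans.trans, Equiv.trans_apply]
  rcases h₁ : g (inr (v, s)) with j | v <;> simp [h₁]

theorem tensor_inr_inr (g : Wiring m n V) (h : Wiring m' n' W) (w : W) (s : Bool) :
    tensor g h (inr (inr w, s)) = Sum.map (Fin.natAdd n) inr (h (inr (w, s))) := by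
  simp only [tensor, Trans.trans, Equiv.trans_apply]
  rcases h₁ : h (inr (w, s)) with j | v <;> simp [h₁]

theorem acyclic_sum {α β : Type} {r : α ⊕ β → α ⊕ β → Prop} {ra : α → α → Prop}
    {rb : β → β → Prop} (ha : ∀ a, ¬ Relation.TransGen ra a a)
    (hb : ∀ b, ¬ Relation.TransGen rb b b)
    (haa : ∀ a a', r (inl a) (inl a') → ra a a')
    (hbb : ∀ b b', r (inr b) (inr b') → rb b b')
    (hba : ∀ b a, ¬ r (inr b) (inl a)) (x : α ⊕ β) : ¬ Relation.TransGen r x x := by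
  have key : ∀ x y, Relation.TransGen r x y →
      (∀ a' : α, y = inl a' → ∃ a, x = inl a ∧ Relation.TransGen ra a a') ∧
      (∀ b : β, x = inr b → ∃ b', y = inr b' ∧ Relation.TransGen rb b b') := by
    intro x y h
    induction h with
    | @single y h =>
      constructor
      · rintro a' rfl
        rcases x with a | b
        · exact ⟨a, rfl, .single (haa _ _ h)⟩
        · exact (hba _ _ h).elim
      · rintro b rfl
        rcases y with a | b'
        · exact (hba _ _ h).elim
        · exact ⟨b', rfl, .single (hbb _ _ h)⟩
    | @tail y z _ h ih =>
      constructor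
      · rintro a' rfl
        rcases y with a | b
        · obtain ⟨a₀, rfl, h₀⟩ := ih.1 a rfl
          exact ⟨a₀, rfl, h₀.tail (haa _ _ h)⟩
        · exact (hba _ _ h).elim
      · rintro b rfl
        obtain ⟨b', rfl, h₀⟩ := ih.2 b rfl
        rcases z with a | c
        · exact (hba _ _ h).elim
        · exact ⟨c, rfl, h₀.tail (hbb _ _ h)⟩
  intro h
  rcases x with a | b
  · obtain ⟨a', e, h'⟩ := (key _ _ h).1 a rfl
    cases e
    exact ha _ h'
  · obtain ⟨b', e, h'⟩ := (key _ _ h).2 b rfl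
    cases e
    exact hb _ h'

theorem Acyclic.comp {g : Wiring m n V} {h : Wiring n p W} (hg : g.Acyclic) (hh : h.Acyclic) :
    (g.comp h).Acyclic := by
  apply acyclic_sum hg hh
  · rintro a a' ⟨s, h₁⟩
    refine ⟨s, ?_⟩
    rw [comp_inr_inl] at h₁
    rcases e : g (inr (a, s)) with j | v
    · rcases e' : h (inl j) with k | w <;> simp [e, e', bridge] at h₁
    · simpa [e, bridge] using h₁
  · rintro a a' ⟨s, h₁⟩
    refine ⟨s, ?_⟩
    rw [comp_inr_inr] at h₁
    rcases e : h (inr (a, s)) with j | v <;> simp [e] at h₁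
    rw [h₁]
  · rintro b a ⟨s, h₁⟩
    rw [comp_inr_inr] at h₁
    rcases e : h (inr (b, s)) with j | v <;> simp [e] at h₁

theorem Acyclic.tensor {g : Wiring m n V} {h : Wiring m' n' W} (hg : g.Acyclic)
    (hh : h.Acyclic) : (g.tensor h).Acyclic := by
  apply acyclic_sum hg hh
  · rintro a a' ⟨s, h₁⟩
    refine ⟨s, ?_⟩
    rw [tensor_inr_inl] at h₁
    rcases e : g (inr (a, s)) with j | v <;> simp [e] at h₁
    rw [h₁]
  · rintro a a' ⟨s, h₁⟩
    refine ⟨s, ?_⟩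
    rw [tensor_inr_inr] at h₁
    rcases e : h (inr (a, s)) with j | v <;> simp [e] at h₁
    rw [h₁]
  · rintro b a ⟨s, h₁⟩
    rw [tensor_inr_inr] at h₁
    rcases e : h (inr (b, s)) with j | v <;> simp [e] at h₁

theorem IsIso.refl (g : Wiring m n V) : IsIso g g (Equiv.refl V) := by
  constructor
  · intro i
    rcases h : g (inl i) with j | w <;> simp
  · intro v s
    rcases h : g (inr (v, s)) with j | w <;> simp [h]

theorem IsIso.symm {g : Wiring m n V} {h : Wiring m n W} {φ : V ≃ W} (H : IsIso g h φ) :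
    IsIso h g φ.symm := by
  constructor
  · intro i
    rw [H.1]
    rcases g (inl i) with j | w <;> simp
  · intro v s
    obtain ⟨v, rfl⟩ := φ.surjective v
    rw [H.2, Equiv.symm_apply_apply]
    rcases g (inr (v, s)) with j | w <;> simp

theorem IsIso.trans {g : Wiring m n U} {h : Wiring m n V} {k : Wiring m n W} {φ : U ≃ V}
    {ψ : V ≃ W} (H : IsIso g h φ) (K : IsIso h k ψ) : IsIso g k (φ.trans ψ) := by
  constructor
  · intro i
    rw [K.1, H.1]
    rcases g (inl i) with j | w <;> simp
  · intro v s
    rw [Equiv.trans_apply, K.2, H.2]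
    rcases g (inr (v, s)) with j | w <;> simp

theorem IsIso.comp {g : Wiring m n V} {g' : Wiring m n V'} {h : Wiring n p W}
    {h' : Wiring n p W'} {φ : V ≃ V'} {ψ : W ≃ W'} (H : IsIso g g' φ) (K : IsIso h h' ψ) :
    IsIso (g.comp h) (g'.comp h') (Equiv.sumCongr φ ψ) := by
  refine ⟨fun i => ?_, fun v s => ?_⟩
  · rw [comp_inl, comp_inl, H.1]
    rcases g (inl i) with j | v
    · simp only [Sum.map_inl, bridge_inl, _root_.id, K.1]
      rcases h (inl j) with _ | _ <;> simp
    · simp [bridge_inr]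
  rcases v with v | w
  · rw [Equiv.sumCongr_apply, Sum.map_inl, comp_inr_inl, comp_inr_inl, H.2]
    rcases g (inr (v, s)) with j | v
    · simp only [Sum.map_inl, bridge_inl, _root_.id, K.1]
      rcases h (inl j) with _ | _ <;> simp
    · simp [bridge_inr]
  · rw [Equiv.sumCongr_apply, Sum.map_inr, comp_inr_inr, comp_inr_inr, K.2]
    rcases h (inr (w, s)) with j | v <;> simp

theorem IsIso.tensor {g : Wiring m n V} {g' : Wiring m n V'} {h : Wiring m' n' W}
    {h' : Wiring m' n' W'} {φ : V ≃ V'} {ψ : W ≃ W'} (H : IsIso g g' φ) (K : IsIso h h' ψ) :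
    IsIso (g.tensor h) (g'.tensor h') (Equiv.sumCongr φ ψ) := by
  refine ⟨fun i => ?_, fun v s => ?_⟩
  · induction i using Fin.addCases with
    | left i =>
      rw [tensor_castAdd, tensor_castAdd, H.1]
      rcases g (inl i) with _ | _ <;> simp
    | right i =>
      rw [tensor_natAdd, tensor_natAdd, K.1]
      rcases h (inl i) with _ | _ <;> simp
  rcases v with v | w
  · rw [Equiv.sumCongr_apply, Sum.map_inl, tensor_inr_inl, tensor_inr_inl, H.2]
    rcases g (inr (v, s)) with _ | _ <;> simp
  · rw [Equiv.sumCongr_apply, Sum.map_inr, tensor_inr_inr, tensor_inr_inr, K.2]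
    rcases h (inr (w, s)) with _ | _ <;> simp

theorem ofEquiv_comp_isIso (e : Fin m ≃ Fin n) (g : Wiring n p V) (k : Wiring m p W)
    (φ : V ≃ W) (h₁ : ∀ i, k (inl i) = Sum.map _root_.id φ (g (inl (e i))))
    (h₂ : ∀ v s, k (inr (φ v, s)) = Sum.map _root_.id φ (g (inr (v, s)))) :
    IsIso ((ofEquiv e).comp g) k ((Equiv.emptySum Empty V).trans φ) := by
  refine ⟨fun i => ?_, fun v s => ?_⟩
  · rw [comp_inl, ofEquiv_inl, h₁, bridge_inl]
    rcases h : g (inl (e i)) with _ | _ <;> simp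
  rcases v with v | w
  · exact v.elim
  · rw [comp_inr_inr, Equiv.trans_apply, Equiv.emptySum_apply_inr, h₂]
    rcases h : g (inr (w, s)) with _ | _ <;> simp

theorem comp_ofEquiv_isIso (e : Fin n ≃ Fin p) (g : Wiring m n V) (k : Wiring m p W)
    (φ : V ≃ W) (h₁ : ∀ i, k (inl i) = Sum.map e φ (g (inl i)))
    (h₂ : ∀ v s, k (inr (φ v, s)) = Sum.map e φ (g (inr (v, s)))) :
    IsIso (g.comp (ofEquiv e)) k ((Equiv.sumEmpty V Empty).trans φ) := by
  refine ⟨fun i => ?_, fun v s => ?_⟩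
  · rw [comp_inl, h₁]
    rcases h : g (inl i) with _ | _ <;> simp [bridge, ofEquiv_inl]
  rcases v with v | w
  · rw [comp_inr_inl, Equiv.trans_apply, Equiv.sumEmpty_apply_inl, h₂]
    rcases h : g (inr (v, s)) with _ | _ <;> simp [bridge, ofEquiv_inl]
  · exact w.elim

theorem comp_assoc (f : Wiring m n U) (g : Wiring n p V) (h : Wiring p q W) :
    IsIso ((f.comp g).comp h) (f.comp (g.comp h)) (Equiv.sumAssoc U V W) := by
  refine ⟨fun i => ?_, fun v s => ?_⟩
  · simp only [comp_inl]
    rcases f (inl i) with j | u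
    · simp only [bridge_inl, comp_inl]
      rcases g (inl j) with k | v
      · simp only [bridge_inl, Sum.map_inl, _root_.id]
        rcases h (inl k) with l | w <;> simp
      · simp [bridge]
    · simp [bridge]
  rcases v with (u | v) | w
  · simp only [Equiv.sumAssoc_apply_inl_inl, comp_inr_inl]
    rcases f (inr (u, s)) with j | u
    · simp only [bridge_inl, comp_inl]
      rcases g (inl j) with k | v
      · simp only [bridge_inl, Sum.map_inl, _root_.id]
        rcases h (inl k) with l | w <;> simp
      · simp [bridge]
    · simp [bridge]
  · simp only [Equiv.sumAssoc_apply_inl_inr, comp_inr_inl, comp_inr_inr]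
    rcases g (inr (v, s)) with k | v
    · simp only [bridge_inl, Sum.map_inl, _root_.id]
      rcases h (inl k) with l | w <;> simp
    · simp [bridge]
  · simp only [Equiv.sumAssoc_apply_inr, comp_inr_inr]
    rcases h (inr (w, s)) with k | v <;> simp

theorem tensor_ofEquiv (e : Fin m ≃ Fin n) (e' : Fin m' ≃ Fin n')
    (e'' : Fin (m + m') ≃ Fin (n + n'))
    (h : ∀ i, e'' (Fin.castAdd m' i) = Fin.castAdd n' (e i))
    (h' : ∀ i, e'' (Fin.natAdd m i) = Fin.natAdd n (e' i)) :
    IsIso ((ofEquiv e).tensor (ofEquiv e')) (ofEquiv e'') (Equiv.emptySum Empty Empty) := by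
  refine ⟨fun i => ?_, fun v => ?_⟩
  · induction i using Fin.addCases with
    | left i => simp [tensor_castAdd, ofEquiv_inl, h]
    | right i => simp [tensor_natAdd, ofEquiv_inl, h']
  · rcases v with v | v <;> exact v.elim

theorem tensor_comp (f : Wiring m n U) (g : Wiring n p V) (f' : Wiring m' n' U')
    (g' : Wiring n' p' V') :
    IsIso ((f.comp g).tensor (f'.comp g')) ((f.tensor f').comp (g.tensor g'))
      (Equiv.sumSumSumComm U V U' V') := by
  refine ⟨fun i => ?_, fun v s => ?_⟩
  · induction i using Fin.addCases with
    | left i =>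
      rw [tensor_castAdd, comp_inl, comp_inl, tensor_castAdd]
      rcases f (inl i) with j | u
      · simp only [bridge_inl, Sum.map_inl, tensor_castAdd]
        rcases g (inl j) with k | v <;> simp
      · simp [bridge]
    | right i =>
      rw [tensor_natAdd, comp_inl, comp_inl, tensor_natAdd]
      rcases f' (inl i) with j | u
      · simp only [bridge_inl, Sum.map_inl, tensor_natAdd]
        rcases g' (inl j) with k | v <;> simp
      · simp [bridge]
  rcases v with (u | v) | (u | v)
  · change ((f.tensor f').comp (g.tensor g')) (inr (inl (inl u), s)) = _
    rw [comp_inr_inl, tensor_inr_inl, tensor_inr_inl, comp_inr_inl]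
    rcases f (inr (u, s)) with j | u
    · simp only [bridge_inl, Sum.map_inl, tensor_castAdd]
      rcases g (inl j) with k | v <;> simp
    · simp [bridge]
  · change ((f.tensor f').comp (g.tensor g')) (inr (inr (inl v), s)) = _
    rw [comp_inr_inr, tensor_inr_inl, tensor_inr_inl, comp_inr_inr]
    rcases g (inr (v, s)) with j | u <;> simp
  · change ((f.tensor f').comp (g.tensor g')) (inr (inl (inr u), s)) = _
    rw [comp_inr_inl, tensor_inr_inr, tensor_inr_inr, comp_inr_inl]
    rcases f' (inr (u, s)) with j | u
    · simp only [bridge_inl, Sum.map_inl, tensor_natAdd]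
      rcases g' (inl j) with k | v <;> simp
    · simp [bridge]
  · change ((f.tensor f').comp (g.tensor g')) (inr (inr (inr v), s)) = _
    rw [comp_inr_inr, tensor_inr_inr, tensor_inr_inr, comp_inr_inr]
    rcases g' (inr (v, s)) with j | u <;> simp

theorem cast_castAdd_castAdd (i : Fin m) (h : m + m' + m'' = m + (m' + m'')) :
    Fin.cast h (Fin.castAdd m'' (Fin.castAdd m' i)) = Fin.castAdd (m' + m'') i := rfl

theorem cast_castAdd_natAdd (i : Fin m') (h : m + m' + m'' = m + (m' + m'')) :
    Fin.cast h (Fin.castAdd m'' (Fin.natAdd m i)) = Fin.natAdd m (Fin.castAdd m'' i) := rfl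

theorem cast_natAdd (i : Fin m'') (h : m + m' + m'' = m + (m' + m'')) :
    Fin.cast h (Fin.natAdd (m + m') i) = Fin.natAdd m (Fin.natAdd m' i) :=
  Fin.ext (Nat.add_assoc _ _ _)

theorem tensor_assoc (f : Wiring m n U) (g : Wiring m' n' V) (h : Wiring m'' n'' W) :
    (∀ i, (f.tensor (g.tensor h)) (inl (Fin.cast (Nat.add_assoc m m' m'') i)) =
      Sum.map (Fin.cast (Nat.add_assoc n n' n'')) (Equiv.sumAssoc U V W)
        (((f.tensor g).tensor h) (inl i))) ∧
    ∀ v s, (f.tensor (g.tensor h)) (inr (Equiv.sumAssoc U V W v, s)) =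
      Sum.map (Fin.cast (Nat.add_assoc n n' n'')) (Equiv.sumAssoc U V W)
        (((f.tensor g).tensor h) (inr (v, s))) := by
  refine ⟨fun i => ?_, fun v s => ?_⟩
  · induction i using Fin.addCases with
    | left i =>
      induction i using Fin.addCases with
      | left i =>
        rw [cast_castAdd_castAdd, tensor_castAdd, tensor_castAdd, tensor_castAdd]
        rcases f (inl i) with j | u
        · simp only [Sum.map_inl, cast_castAdd_castAdd]
        · simp
      | right i =>
        rw [cast_castAdd_natAdd, tensor_natAdd, tensor_castAdd, tensor_castAdd, tensor_natAdd]
        rcases g (inl i) with j | u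
        · simp only [Sum.map_inl, cast_castAdd_natAdd]
        · simp
    | right i =>
      rw [cast_natAdd, tensor_natAdd, tensor_natAdd, tensor_natAdd]
      rcases h (inl i) with j | u
      · simp only [Sum.map_inl, cast_natAdd]
      · simp
  rcases v with (u | v) | w
  · rw [Equiv.sumAssoc_apply_inl_inl, tensor_inr_inl, tensor_inr_inl, tensor_inr_inl]
    rcases f (inr (u, s)) with j | u
    · simp only [Sum.map_inl, cast_castAdd_castAdd]
    · simp
  · rw [Equiv.sumAssoc_apply_inl_inr, tensor_inr_inl, tensor_inr_inr, tensor_inr_inl,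
      tensor_inr_inr]
    rcases g (inr (v, s)) with j | u
    · simp only [Sum.map_inl, cast_castAdd_natAdd]
    · simp
  · rw [Equiv.sumAssoc_apply_inr, tensor_inr_inr, tensor_inr_inr, tensor_inr_inr]
    rcases h (inr (w, s)) with j | u
    · simp only [Sum.map_inl, cast_natAdd]
    · simp

theorem cast_natAdd_zero (i : Fin m) : Fin.cast (Nat.zero_add m) (Fin.natAdd 0 i) = i :=
  Fin.ext (Nat.zero_add _)

theorem zero_tensor (f : Wiring m n U) :
    (∀ i, f (inl (Fin.cast (Nat.zero_add m) i)) =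
      Sum.map (Fin.cast (Nat.zero_add n)) (Equiv.emptySum Empty U)
        (((ofEquiv (Equiv.refl (Fin 0))).tensor f) (inl i))) ∧
    ∀ v s, f (inr (Equiv.emptySum Empty U v, s)) =
      Sum.map (Fin.cast (Nat.zero_add n)) (Equiv.emptySum Empty U)
        (((ofEquiv (Equiv.refl (Fin 0))).tensor f) (inr (v, s))) := by
  refine ⟨fun i => ?_, fun v s => ?_⟩
  · induction i using Fin.addCases with
    | left i => exact i.elim0
    | right i =>
      rw [tensor_natAdd, cast_natAdd_zero]
      rcases f (inl i) with j | u
      · simp only [Sum.map_inl, cast_natAdd_zero]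
      · simp
  rcases v with v | v
  · exact v.elim
  · rw [tensor_inr_inr, Equiv.emptySum_apply_inr]
    rcases f (inr (v, s)) with j | u
    · simp only [Sum.map_inl, cast_natAdd_zero]
    · simp

theorem tensor_zero (f : Wiring m n U) :
    IsIso (f.tensor (ofEquiv (Equiv.refl (Fin 0)))) f (Equiv.sumEmpty U Empty) := by
  refine ⟨fun i => ?_, fun v s => ?_⟩
  · induction i using Fin.addCases with
    | left i =>
      rw [tensor_castAdd]
      change f (inl i) = _
      rcases f (inl i) with j | u <;> simp [Fin.castAdd]
    | right i => exact i.elim0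
  rcases v with v | v
  · rw [tensor_inr_inl, Equiv.sumEmpty_apply_inl]
    rcases f (inr (v, s)) with j | u <;> simp [Fin.castAdd]
  · exact v.elim

theorem symm_natural (f : Wiring m n U) (g : Wiring m' n' V) :
    IsIso ((ofEquiv finAddFlip).comp (g.tensor f)) ((f.tensor g).comp (ofEquiv finAddFlip))
      ((Equiv.emptySum Empty _).trans
        ((Equiv.sumComm V U).trans (Equiv.sumEmpty (U ⊕ V) Empty).symm)) := by
  refine ofEquiv_comp_isIso _ _ _ _ (fun i => ?_) (fun v s => ?_)
  · induction i using Fin.addCases with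
    | left i =>
      rw [comp_inl, tensor_castAdd, finAddFlip_apply_castAdd, tensor_natAdd]
      rcases f (inl i) with j | u <;> simp [bridge, ofEquiv_inl]
    | right i =>
      rw [comp_inl, tensor_natAdd, finAddFlip_apply_natAdd, tensor_castAdd]
      rcases g (inl i) with j | u <;> simp [bridge, ofEquiv_inl]
  rcases v with v | v
  · change ((f.tensor g).comp _) (inr (inl (inr v), s)) = _
    rw [comp_inr_inl, tensor_inr_inr, tensor_inr_inl]
    rcases g (inr (v, s)) with j | u <;> simp [bridge, ofEquiv_inl]
  · change ((f.tensor g).comp _) (inr (inl (inl v), s)) = _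
    rw [comp_inr_inl, tensor_inr_inr, tensor_inr_inl]
    rcases f (inr (v, s)) with j | u <;> simp [bridge, ofEquiv_inl]

theorem ofEquiv_comp_ofEquiv (e : Fin m ≃ Fin n) (e' : Fin n ≃ Fin p) :
    IsIso ((ofEquiv e).comp (ofEquiv e')) (ofEquiv (e.trans e'))
      ((Equiv.emptySum Empty Empty).trans (Equiv.refl Empty)) :=
  ofEquiv_comp_isIso _ _ _ (Equiv.refl Empty) (fun _ => rfl) (fun v => v.elim)

/-- The hexagon identity for block transpositions, as an identity of permutations. -/
theorem finAddFlip_hexagon (i : Fin (m + n + p)) :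
    Fin.cast (Nat.add_assoc n p m) (finAddFlip (Fin.cast (Nat.add_assoc m n p) i)) =
      finSumFinEquiv (Sum.map _root_.id finAddFlip (finSumFinEquiv.symm
        (Fin.cast (Nat.add_assoc n m p) (finSumFinEquiv
          (Sum.map finAddFlip _root_.id (finSumFinEquiv.symm i)))))) := by
  induction i using Fin.addCases with
  | left i =>
    induction i using Fin.addCases with
    | left i =>
      rw [cast_castAdd_castAdd, finAddFlip_apply_castAdd, cast_natAdd]
      simp [cast_castAdd_natAdd]
    | right i =>
      rw [cast_castAdd_natAdd, finAddFlip_apply_natAdd, cast_castAdd_castAdd]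
      simp only [finSumFinEquiv_symm_apply_castAdd, Sum.map_inl, finAddFlip_apply_natAdd,
        finSumFinEquiv_apply_left, cast_castAdd_castAdd, _root_.id]
  | right i =>
    rw [cast_natAdd, finAddFlip_apply_natAdd, cast_castAdd_natAdd]
    simp only [finSumFinEquiv_symm_apply_natAdd, Sum.map_inr, finAddFlip_apply_natAdd,
        finSumFinEquiv_apply_right, cast_natAdd, _root_.id]

end

end Wiring

/-- A finite directed acyclic graph with `m` ordered input half-edges, `n` ordered output
half-edges and finitely many internal vertices, each with one incoming half-edge and an ordered
pair of outgoing half-edges. -/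
structure Diagram (m n : ℕ) : Type 1 where
  V : Type
  finite : Finite V
  wire : Wiring m n V
  acyclic : wire.Acyclic

namespace Diagram

/-- Diagrams are isomorphic if some bijection of internal vertices preserves all wires, with
their positions at the inputs, at the outputs and at the vertices. -/
def Iso {m n : ℕ} (G H : Diagram m n) : Prop :=
  ∃ φ : G.V ≃ H.V, G.wire.IsIso H.wire φ

/-- Isomorphism of diagrams, as an equivalence relation. -/
def isoSetoid (m n : ℕ) : Setoid (Diagram m n) where
  r := Iso
  iseqv :=
    { refl := fun G => ⟨_, Wiring.IsIso.refl G.wire⟩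
      symm := fun ⟨_, h⟩ => ⟨_, h.symm⟩
      trans := fun ⟨_, h⟩ ⟨_, k⟩ => ⟨_, h.trans k⟩ }

/-- The vertex-free diagram given by a bijection from inputs to outputs. -/
def ofEquiv {m n : ℕ} (e : Fin m ≃ Fin n) : Diagram m n where
  V := Empty
  finite := inferInstance
  wire := Wiring.ofEquiv e
  acyclic v := v.elim

/-- Composition: gluing of the outputs of `G` to the inputs of `H`. -/
def comp {m n p : ℕ} (G : Diagram m n) (H : Diagram n p) : Diagram m p where
  V := G.V ⊕ H.V
  finite := by
    have := G.finite
    have := H.finite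
    infer_instance
  wire := G.wire.comp H.wire
  acyclic := G.acyclic.comp H.acyclic

/-- Tensor: disjoint union, with concatenated boundaries. -/
def tensor {m n m' n' : ℕ} (G : Diagram m n) (H : Diagram m' n') :
    Diagram (m + m') (n + n') where
  V := G.V ⊕ H.V
  finite := by
    have := G.finite
    have := H.finite
    infer_instance
  wire := G.wire.tensor H.wire
  acyclic := G.acyclic.tensor H.acyclic

/-- The diagram `1 → 2` with exactly one internal vertex `v`: the input is joined to `v`, the
left outgoing half-edge of `v` to the first output and the right one to the second output. -/
def delta : Diagram 1 2 where
  V := Unit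
  finite := inferInstance
  wire :=
    { toFun := Sum.elim (fun _ => inr ()) (fun x => inl (bif x.2 then 1 else 0))
      invFun := Sum.elim (fun j => inr ((), j == 1)) (fun _ => inl 0)
      left_inv := by
        rintro (i | ⟨_, _ | _⟩)
        · simp [Subsingleton.elim i 0]
        · simp
        · simp
      right_inv := by
        rintro (j | v)
        · fin_cases j <;> simp
        · rfl }
  acyclic v h := by
    cases h with
    | single h => exact absurd h (by simp)
    | tail _ h => exact absurd h (by simp)

theorem comp_congr {m n p : ℕ} {G G' : Diagram m n} {H H' : Diagram n p} :
    Iso G G' → Iso H H' → Iso (G.comp H) (G'.comp H') :=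
  fun ⟨_, h⟩ ⟨_, k⟩ => ⟨_, h.comp k⟩

theorem tensor_congr {m n m' n' : ℕ} {G G' : Diagram m n} {H H' : Diagram m' n'} :
    Iso G G' → Iso H H' → Iso (G.tensor H) (G'.tensor H') :=
  fun ⟨_, h⟩ ⟨_, k⟩ => ⟨_, h.tensor k⟩

theorem ofEquiv_comp_ofEquiv {m n p : ℕ} (e : Fin m ≃ Fin n) (e' : Fin n ≃ Fin p) :
    Iso ((ofEquiv e).comp (ofEquiv e')) (ofEquiv (e.trans e')) :=
  ⟨_, Wiring.ofEquiv_comp_ofEquiv e e'⟩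

theorem castHom_iso {m n m' n' : ℕ} (hm : m = m') (hn : n = n') (G : Diagram m n)
    (K : Diagram m' n') (φ : G.V ≃ K.V)
    (h : (∀ i, K.wire (inl (Fin.cast hm i)) = Sum.map (Fin.cast hn) φ (G.wire (inl i))) ∧
      ∀ v s, K.wire (inr (φ v, s)) = Sum.map (Fin.cast hn) φ (G.wire (inr (v, s)))) :
    Iso (castHom hm hn G) K := by
  subst hm hn
  exact ⟨φ, h⟩

/-- Composition of isomorphism classes of diagrams. -/
def qcomp {m n p : ℕ} (f : Quotient (isoSetoid m n)) (g : Quotient (isoSetoid n p)) :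
    Quotient (isoSetoid m p) :=
  Quotient.map₂ comp (fun _ _ (h : Iso _ _) _ _ (k : Iso _ _) => comp_congr h k) f g

/-- Tensor of isomorphism classes of diagrams. -/
def qtensor {m n m' n' : ℕ} (f : Quotient (isoSetoid m n)) (g : Quotient (isoSetoid m' n')) :
    Quotient (isoSetoid (m + m') (n + n')) :=
  Quotient.map₂ tensor (fun _ _ (h : Iso _ _) _ _ (k : Iso _ _) => tensor_congr h k) f g

theorem qcomp_mk {m n p : ℕ} (G : Diagram m n) (H : Diagram n p) :
    qcomp (Quotient.mk _ G) (Quotient.mk _ H) = Quotient.mk _ (G.comp H) := rfl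

theorem qtensor_mk {m n m' n' : ℕ} (G : Diagram m n) (H : Diagram m' n') :
    qtensor (Quotient.mk _ G) (Quotient.mk _ H) = Quotient.mk _ (G.tensor H) := rfl

theorem mk_ofEquiv_comp {m n p : ℕ} (e : Fin m ≃ Fin n) (e' : Fin n ≃ Fin p) :
    Quotient.mk (isoSetoid m p) ((ofEquiv e).comp (ofEquiv e')) =
      Quotient.mk (isoSetoid m p) (ofEquiv (e.trans e')) :=
  Quotient.sound (ofEquiv_comp_ofEquiv e e')

theorem castHom_mk_ofEquiv {m n m' n' : ℕ} (hm : m = m') (hn : n = n') (e : Fin m ≃ Fin n) :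
    castHom (H := fun m n => Quotient (isoSetoid m n)) hm hn (Quotient.mk _ (ofEquiv e)) =
      Quotient.mk _ (ofEquiv (((finCongr hm).symm.trans e).trans (finCongr hn))) := by
  subst hm hn
  rfl

theorem castHom_mk_tensor {a b c d a' b' : ℕ} (ha : a + c = a') (hb : b + d = b')
    (u : Fin a ≃ Fin b) (w : Fin c ≃ Fin d) :
    castHom (H := fun m n => Quotient (isoSetoid m n)) ha hb
      (Quotient.mk _ ((ofEquiv u).tensor (ofEquiv w))) =
    Quotient.mk _ (ofEquiv (((finCongr ha).symm.trans
      ((finSumFinEquiv.symm.trans (Equiv.sumCongr u w)).trans finSumFinEquiv)).trans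
        (finCongr hb))) := by
  subst ha hb
  exact Quotient.sound
    ⟨_, Wiring.tensor_ofEquiv _ _ _ (fun _ => by simp) (fun _ => by simp)⟩

theorem mk_symm_symm (m n : ℕ) :
    qcomp (Quotient.mk _ (ofEquiv (finAddFlip (m := m) (n := n))))
      (Quotient.mk _ (ofEquiv finAddFlip)) =
    Quotient.mk (isoSetoid (m + n) (m + n)) (ofEquiv (Equiv.refl _)) := by
  rw [qcomp_mk, mk_ofEquiv_comp]
  congr 2
  ext i
  induction i using Fin.addCases <;> simp

theorem mk_symm_natural {m n m' n' : ℕ} (F : Diagram m n) (G : Diagram m' n') :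
    qcomp (qtensor (Quotient.mk _ F) (Quotient.mk _ G)) (Quotient.mk _ (ofEquiv finAddFlip)) =
      qcomp (Quotient.mk _ (ofEquiv finAddFlip))
        (qtensor (Quotient.mk _ G) (Quotient.mk _ F)) := by
  rw [qtensor_mk, qtensor_mk, qcomp_mk, qcomp_mk]
  symm
  exact Quotient.sound (s := isoSetoid (m + m') (n' + n))
    (⟨_, Wiring.symm_natural F.wire G.wire⟩ : Iso _ _)

theorem mk_symm_hexagon (m n p : ℕ) :
    castHom (H := fun m n => Quotient (isoSetoid m n)) (Nat.add_assoc m n p).symm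
      (Nat.add_assoc n p m) (Quotient.mk _ (ofEquiv finAddFlip)) =
    qcomp
      (castHom (H := fun m n => Quotient (isoSetoid m n)) rfl (Nat.add_assoc n m p)
        (qtensor (Quotient.mk _ (ofEquiv finAddFlip)) (Quotient.mk _ (ofEquiv (Equiv.refl (Fin p))))))
      (qtensor (Quotient.mk _ (ofEquiv (Equiv.refl (Fin n)))) (Quotient.mk _ (ofEquiv finAddFlip))) := by
  have k := castHom_mk_tensor rfl rfl (Equiv.refl (Fin n)) (finAddFlip (m := m) (n := p))
  rw [show ∀ {a b : ℕ} (x : Quotient (isoSetoid a b)),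
    castHom (H := fun m n => Quotient (isoSetoid m n)) rfl rfl x = x from fun _ => rfl] at k
  rw [qtensor_mk, qtensor_mk, castHom_mk_ofEquiv, castHom_mk_tensor, k, qcomp_mk, mk_ofEquiv_comp]
  congr 2
  ext i : 1
  exact Wiring.finAddFlip_hexagon i

end Diagram

/-- The PROP `Syn(δ)`: morphisms `m → n` are isomorphism classes of diagrams. -/
def Syn : PROP.{1} where
  Hom m n := Quotient (Diagram.isoSetoid m n)
  id n := Quotient.mk _ (Diagram.ofEquiv (Equiv.refl (Fin n)))
  comp f g := Diagram.qcomp f g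
  tensor f g := Diagram.qtensor f g
  symm m n := Quotient.mk _ (Diagram.ofEquiv finAddFlip)
  id_comp f := by
    induction f using Quotient.ind
    exact Quotient.sound ⟨_, Wiring.ofEquiv_comp_isIso _ _ _ (Equiv.refl _) (fun _ => by simp)
      (fun _ _ => by simp)⟩
  comp_id f := by
    induction f using Quotient.ind
    exact Quotient.sound ⟨_, Wiring.comp_ofEquiv_isIso _ _ _ (Equiv.refl _) (fun _ => by simp)
      (fun _ _ => by simp)⟩
  comp_assoc f g h := by
    induction f using Quotient.ind
    induction g using Quotient.ind
    induction h using Quotient.ind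
    exact Quotient.sound ⟨_, Wiring.comp_assoc _ _ _⟩
  tensor_id m n := Quotient.sound
    ⟨_, Wiring.tensor_ofEquiv _ _ _ (fun _ => rfl) (fun _ => rfl)⟩
  tensor_comp f g f' g' := by
    induction f using Quotient.ind
    induction g using Quotient.ind
    induction f' using Quotient.ind
    induction g' using Quotient.ind
    exact Quotient.sound ⟨_, Wiring.tensor_comp _ _ _ _⟩
  tensor_assoc f g h := by
    induction f using Quotient.ind
    induction g using Quotient.ind
    induction h using Quotient.ind
    exact (castHom_map (H := Diagram) (fun {m n} f => Quotient.mk (Diagram.isoSetoid m n) f)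
      _ _ _).symm.trans (Quotient.sound
        (Diagram.castHom_iso _ _ _ _ _ (Wiring.tensor_assoc _ _ _)))
  zero_tensor f := by
    induction f using Quotient.ind
    exact (castHom_map (H := Diagram) (fun {m n} f => Quotient.mk (Diagram.isoSetoid m n) f)
      _ _ _).symm.trans (Quotient.sound
        (Diagram.castHom_iso _ _ _ _ _ (Wiring.zero_tensor _)))
  tensor_zero f := by
    induction f using Quotient.ind
    exact Quotient.sound ⟨_, Wiring.tensor_zero _⟩
  symm_natural f g := by
    induction f using Quotient.ind
    induction g using Quotient.ind
    exact Diagram.mk_symm_natural _ _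
  symm_symm m n := Diagram.mk_symm_symm m n
  symm_hexagon m n p := Diagram.mk_symm_hexagon m n p

/-- The generator `δ : 1 → 2` of `Syn(δ)`. -/
def Syn.delta : Syn.Hom 1 2 := Quotient.mk _ Diagram.delta

/-! ### The PROP `FinCorel` of finite corelations -/

/-- Corelations `m → n`: equivalence relations on `{1, …, m} ⊔ {1, …, n}`. -/
abbrev Corel (m n : ℕ) : Type := Setoid (Fin m ⊕ Fin n)

namespace Corel

/-- The union of two corelations, as a relation on `{1, …, m} ⊔ {1, …, n} ⊔ {1, …, p}`. -/
inductive Glue {m n p : ℕ} (R : Corel m n) (S : Corel n p) :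
    Fin m ⊕ (Fin n ⊕ Fin p) → Fin m ⊕ (Fin n ⊕ Fin p) → Prop
  | left {x y : Fin m ⊕ Fin n} (h : R x y) : Glue R S (Sum.map id inl x) (Sum.map id inl y)
  | right {x y : Fin n ⊕ Fin p} (h : S x y) : Glue R S (inr x) (inr y)

/-- Composition of corelations: the restriction to the outer boundary of the equivalence relation
generated by the union (which is its transitive closure, the union being already reflexive and
symmetric). -/
@[reducible] def comp {m n p : ℕ} (R : Corel m n) (S : Corel n p) : Corel m p :=
  (Relation.EqvGen.setoid (Glue R S)).comap (Sum.map id inr)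

/-- The disjoint union of two equivalence relations. -/
@[reducible] def sumSetoid {α β : Type} (R : Setoid α) (S : Setoid β) : Setoid (α ⊕ β) where
  r := Sum.LiftRel R S
  iseqv :=
    { refl := by
        rintro (x | x)
        · exact .inl (R.refl x)
        · exact .inr (S.refl x)
      symm := by
        rintro _ _ (h | h)
        · exact .inl (R.symm h)
        · exact .inr (S.symm h)
      trans := by
        rintro _ _ _ (h | h) (k | k)
        · exact .inl (R.trans h k)
        · exact .inr (S.trans h k) }

/-- Sorting the boundary elements of a tensor product into the two blocks. -/
def split (m n m' n' : ℕ) :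
    Fin (m + m') ⊕ Fin (n + n') ≃ (Fin m ⊕ Fin n) ⊕ (Fin m' ⊕ Fin n') :=
  (Equiv.sumCongr finSumFinEquiv.symm finSumFinEquiv.symm).trans (Equiv.sumSumSumComm _ _ _ _)

/-- Tensor of corelations: disjoint union with reindexing. -/
@[reducible] def tensor {m n m' n' : ℕ} (R : Corel m n) (S : Corel m' n') : Corel (m + m') (n + n') :=
  (sumSetoid R S).comap (split m n m' n')

/-- The corelation of a bijection `e`: input `i` is equivalent exactly to itself and to output
`e i`. -/
@[reducible] def ofEquiv {m n : ℕ} (e : Fin m ≃ Fin n) : Corel m n := Setoid.ker (Sum.elim e id)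

/-- The functions `a`, `b` are constant on the classes of `R`. -/
def Sat {m n : ℕ} {Z : Type} (R : Corel m n) (a : Fin m → Z) (b : Fin n → Z) : Prop :=
  ∀ x y, R x y → Sum.elim a b x = Sum.elim a b y

section

variable {m n p q m' n' p' m'' n'' : ℕ} {Z Z' : Type}

theorem ext_sat {R S : Corel m n}
    (h : ∀ (Z : Type) (a : Fin m → Z) (b : Fin n → Z), Sat R a b ↔ Sat S a b) : R = S := by
  have key : ∀ {R S : Corel m n}, (∀ (Z : Type) (a : Fin m → Z) (b : Fin n → Z),
      Sat S a b → Sat R a b) → R ≤ S := by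
    intro R S h x y hxy
    have := h (Quotient S) (fun i => Quotient.mk S (inl i)) (fun j => Quotient.mk S (inr j))
      (by rintro (x | x) (y | y) k <;> exact Quotient.sound k) x y hxy
    rcases x with x | x <;> rcases y with y | y <;> exact Quotient.exact this
  exact le_antisymm (key fun Z a b => (h Z a b).2) (key fun Z a b => (h Z a b).1)

theorem sat_inj {R : Corel m n} {ι : Z → Z'} (hι : Function.Injective ι) (a : Fin m → Z)
    (b : Fin n → Z) : Sat R (ι ∘ a) (ι ∘ b) ↔ Sat R a b := by
  have e : ∀ x, Sum.elim (ι ∘ a) (ι ∘ b) x = ι (Sum.elim a b x) := by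
    rintro (x | x) <;> rfl
  simp only [Sat, e, hι.eq_iff]

theorem sat_comp {R : Corel m n} {S : Corel n p} {a : Fin m → Z} {b : Fin n → Z}
    {c : Fin p → Z} (hR : Sat R a b) (hS : Sat S b c) : Sat (comp R S) a c := by
  have key : ∀ x y, Relation.EqvGen (Glue R S) x y →
      Sum.elim a (Sum.elim b c) x = Sum.elim a (Sum.elim b c) y := by
    intro x y h
    induction h with
    | rel x y h =>
      rcases h with h | h
      · rename_i x y
        have := hR x y h
        rcases x with x | x <;> rcases y with y | y <;> exact this
      · exact hS _ _ h
    | refl => rfl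
    | symm _ _ _ ih => exact ih.symm
    | trans _ _ _ _ _ ih ih' => exact ih.trans ih'
  intro x y h
  have := key _ _ h
  rcases x with x | x <;> rcases y with y | y <;> exact this

theorem exists_of_sat_comp {R : Corel m n} {S : Corel n p} {a : Fin m → Z} {c : Fin p → Z}
    (h : Sat (comp R S) a c) :
    ∃ b : Fin n → Option Z, Sat R (some ∘ a) b ∧ Sat S b (some ∘ c) := by
  classical
  let E := Relation.EqvGen.setoid (Glue R S)
  let P : (Fin m ⊕ Fin p → Prop) → Option Z := fun q =>
    if k : ∃ x, q x then some (Sum.elim a c k.choose) else none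
  let F : Fin m ⊕ (Fin n ⊕ Fin p) → Option Z := fun t => P fun x => E (Sum.map id inr x) t
  have hF : ∀ s t, E s t → F s = F t := by
    intro s t hst
    have e : (fun x : Fin m ⊕ Fin p => E (Sum.map id inr x) s) =
        fun x : Fin m ⊕ Fin p => E (Sum.map id inr x) t :=
      funext fun x => propext ⟨fun k => E.trans k hst, fun k => E.trans k (E.symm hst)⟩
    exact congrArg P e
  have hF' : ∀ x, F (Sum.map id inr x) = some (Sum.elim a c x) := by
    intro x
    have k : ∃ y : Fin m ⊕ Fin p, E (Sum.map id inr y) (Sum.map id inr x) := ⟨x, E.refl _⟩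
    simp only [F, P]
    rw [dif_pos k]
    exact congrArg some (h _ _ k.choose_spec)
  refine ⟨fun j => F (inr (inl j)), ?_, ?_⟩
  · have e : ∀ x, Sum.elim (some ∘ a) (fun j => F (inr (inl j))) x = F (Sum.map id inl x) := by
      rintro (x | x)
      · exact (hF' (inl x)).symm
      · rfl
    intro x y hxy
    rw [e, e]
    exact hF _ _ (.rel _ _ (.left hxy))
  · have e : ∀ x, Sum.elim (fun j => F (inr (inl j))) (some ∘ c) x = F (inr x) := by
      rintro (x | x)
      · rfl
      · exact (hF' (inr x)).symm
    intro x y hxy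
    rw [e, e]
    exact hF _ _ (.rel _ _ (.right hxy))

theorem sat_comp_of_inj {R : Corel m n} {S : Corel n p} {a : Fin m → Z} {b : Fin n → Z'}
    {c : Fin p → Z} {ι : Z → Z'} (hι : Function.Injective ι) (hR : Sat R (ι ∘ a) b)
    (hS : Sat S b (ι ∘ c)) : Sat (comp R S) a c :=
  (sat_inj hι a c).1 (sat_comp hR hS)

theorem sat_tensor {R : Corel m n} {S : Corel m' n'} {a : Fin (m + m') → Z}
    {b : Fin (n + n') → Z} :
    Sat (tensor R S) a b ↔ Sat R (fun i => a (Fin.castAdd m' i)) (fun j => b (Fin.castAdd n' j)) ∧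
      Sat S (fun i => a (Fin.natAdd m i)) (fun j => b (Fin.natAdd n j)) := by
  have e₁ : ∀ x, Sum.elim (fun i => a (Fin.castAdd m' i)) (fun j => b (Fin.castAdd n' j)) x =
      Sum.elim a b ((split m n m' n').symm (inl x)) := by
    rintro (x | x) <;> simp [split]
  have e₂ : ∀ x, Sum.elim (fun i => a (Fin.natAdd m i)) (fun j => b (Fin.natAdd n j)) x =
      Sum.elim a b ((split m n m' n').symm (inr x)) := by
    rintro (x | x) <;> simp [split]
  have h : Sat (tensor R S) a b ↔ ∀ x y, Sum.LiftRel R S x y →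
      Sum.elim a b ((split m n m' n').symm x) = Sum.elim a b ((split m n m' n').symm y) := by
    constructor
    · intro H x y hxy
      refine H _ _ ?_
      change Sum.LiftRel R S (split m n m' n' _) (split m n m' n' _)
      simpa using hxy
    · intro H x y hxy
      have := H _ _ (show Sum.LiftRel R S (split m n m' n' x) (split m n m' n' y) from hxy)
      simpa using this
  rw [h]
  constructor
  · intro H
    refine ⟨fun x y hxy => ?_, fun x y hxy => ?_⟩
    · rw [e₁, e₁]
      exact H _ _ (.inl hxy)
    · rw [e₂, e₂]
      exact H _ _ (.inr hxy)
  · rintro ⟨H₁, H₂⟩ _ _ (hxy | hxy)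
    · rw [← e₁, ← e₁]
      exact H₁ _ _ hxy
    · rw [← e₂, ← e₂]
      exact H₂ _ _ hxy

theorem sat_ofEquiv {e : Fin m ≃ Fin n} {a : Fin m → Z} {b : Fin n → Z} :
    Sat (ofEquiv e) a b ↔ ∀ i, a i = b (e i) := by
  constructor
  · intro H i
    exact H (inl i) (inr (e i)) rfl
  · intro H x y hxy
    have k : ∀ x, Sum.elim a b x = b (Sum.elim e id x) := by
      rintro (x | x)
      · exact H x
      · rfl
    rw [k, k]
    exact congrArg b hxy

theorem sat_castHom (hm : m = m') (hn : n = n') {R : Corel m n} {a : Fin m' → Z}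
    {b : Fin n' → Z} :
    Sat (castHom (H := Corel) hm hn R) a b ↔
      Sat R (fun i => a (Fin.cast hm i)) (fun j => b (Fin.cast hn j)) := by
  subst hm hn
  rfl

theorem sat_ofEquiv_comp {e : Fin m ≃ Fin n} {R : Corel n p} {a : Fin m → Z} {c : Fin p → Z} :
    Sat (comp (ofEquiv e) R) a c ↔ Sat R (fun i => a (e.symm i)) c := by
  constructor
  · intro H
    obtain ⟨b, h₁, h₂⟩ := exists_of_sat_comp H
    rw [sat_ofEquiv] at h₁
    refine (sat_inj (Option.some_injective Z) _ _).1 ?_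
    convert h₂ using 1
    ext1 i
    simpa using h₁ (e.symm i)
  · intro H
    exact sat_comp (sat_ofEquiv.2 fun i => by simp) H

theorem sat_comp_ofEquiv {e : Fin n ≃ Fin p} {R : Corel m n} {a : Fin m → Z} {c : Fin p → Z} :
    Sat (comp R (ofEquiv e)) a c ↔ Sat R a (fun j => c (e j)) := by
  constructor
  · intro H
    obtain ⟨b, h₁, h₂⟩ := exists_of_sat_comp H
    rw [sat_ofEquiv] at h₂
    refine (sat_inj (Option.some_injective Z) _ _).1 ?_
    convert h₁ using 1
    ext1 i
    exact (h₂ i).symm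
  · intro H
    exact sat_comp H (sat_ofEquiv.2 fun i => rfl)

theorem castHom_ofEquiv (hm : m = m') (hn : n = n') (e : Fin m ≃ Fin n) :
    castHom (H := Corel) hm hn (ofEquiv e) =
      ofEquiv (((finCongr hm).symm.trans e).trans (finCongr hn)) := by
  subst hm hn
  rfl

theorem ofEquiv_comp_ofEquiv (e : Fin m ≃ Fin n) (e' : Fin n ≃ Fin p) :
    comp (ofEquiv e) (ofEquiv e') = ofEquiv (e.trans e') :=
  ext_sat fun Z a b => by
    rw [sat_comp_ofEquiv, sat_ofEquiv, sat_ofEquiv]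
    rfl

theorem tensor_ofEquiv (e : Fin m ≃ Fin n) (e' : Fin m' ≃ Fin n') :
    tensor (ofEquiv e) (ofEquiv e') =
      ofEquiv ((finSumFinEquiv.symm.trans (Equiv.sumCongr e e')).trans finSumFinEquiv) :=
  ext_sat fun Z a b => by
    rw [sat_tensor, sat_ofEquiv, sat_ofEquiv, sat_ofEquiv]
    constructor
    · rintro ⟨h, h'⟩ i
      induction i using Fin.addCases with
      | left i => simpa using h i
      | right i => simpa using h' i
    · intro h
      exact ⟨fun i => by simpa using h (Fin.castAdd m' i),
        fun i => by simpa using h (Fin.natAdd m i)⟩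

theorem tensor_sat_addCases {R : Corel m n} {S : Corel m' n'} {a : Fin (m + m') → Z}
    {b₁ : Fin n → Z} {b₂ : Fin n' → Z} (h₁ : Sat R (fun i => a (Fin.castAdd m' i)) b₁)
    (h₂ : Sat S (fun i => a (Fin.natAdd m i)) b₂) :
    Sat (tensor R S) a (Fin.addCases b₁ b₂) := by
  refine sat_tensor.2 ⟨?_, ?_⟩
  · simpa only [Fin.addCases_left] using h₁
  · simpa only [Fin.addCases_right] using h₂

theorem tensor_sat_addCases' {R : Corel m n} {S : Corel m' n'} {a₁ : Fin m → Z}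
    {a₂ : Fin m' → Z} {b : Fin (n + n') → Z} (h₁ : Sat R a₁ (fun i => b (Fin.castAdd n' i)))
    (h₂ : Sat S a₂ (fun i => b (Fin.natAdd n i))) :
    Sat (tensor R S) (Fin.addCases a₁ a₂) b := by
  refine sat_tensor.2 ⟨?_, ?_⟩
  · simpa only [Fin.addCases_left] using h₁
  · simpa only [Fin.addCases_right] using h₂

end

end Corel

open Corel in
/-- The PROP `FinCorel` of finite corelations. -/
def FinCorel : PROP.{0} where
  Hom := Corel
  id n := ofEquiv (Equiv.refl (Fin n))
  comp := Corel.comp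
  tensor := Corel.tensor
  symm m n := ofEquiv finAddFlip
  id_comp R := ext_sat fun Z a c => sat_ofEquiv_comp
  comp_id R := ext_sat fun Z a c => sat_comp_ofEquiv
  comp_assoc R S T := ext_sat fun Z a d => by
    constructor
    · intro H
      obtain ⟨c, h₁, h₂⟩ := exists_of_sat_comp H
      obtain ⟨b, h₃, h₄⟩ := exists_of_sat_comp h₁
      have hi : Function.Injective (some ∘ some : Z → Option (Option Z)) :=
        (Option.some_injective _).comp (Option.some_injective _)
      exact sat_comp_of_inj hi h₃
        (sat_comp h₄ ((sat_inj (Option.some_injective _) _ _).2 h₂))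
    · intro H
      obtain ⟨b, h₁, h₂⟩ := exists_of_sat_comp H
      obtain ⟨c, h₃, h₄⟩ := exists_of_sat_comp h₂
      have hi : Function.Injective (some ∘ some : Z → Option (Option Z)) :=
        (Option.some_injective _).comp (Option.some_injective _)
      exact sat_comp_of_inj hi
        (sat_comp ((sat_inj (Option.some_injective _) _ _).2 h₁) h₃) h₄
  tensor_id m n := ext_sat fun Z a b => by
    rw [sat_tensor, sat_ofEquiv, sat_ofEquiv, sat_ofEquiv]
    exact ⟨fun h i => Fin.addCases h.1 h.2 i, fun h => ⟨fun i => h _, fun i => h _⟩⟩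
  tensor_comp R S R' S' := ext_sat fun Z a c => by
    constructor
    · intro H
      obtain ⟨h, h'⟩ := sat_tensor.1 H
      obtain ⟨b, h₁, h₂⟩ := exists_of_sat_comp h
      obtain ⟨b', h₁', h₂'⟩ := exists_of_sat_comp h'
      exact sat_comp_of_inj (Option.some_injective _)
        (tensor_sat_addCases (a := some ∘ a) h₁ h₁') (tensor_sat_addCases' (b := some ∘ c) h₂ h₂')
    · intro H
      obtain ⟨b, h₁, h₂⟩ := exists_of_sat_comp H
      obtain ⟨h₃, h₃'⟩ := sat_tensor.1 h₁
      obtain ⟨h₄, h₄'⟩ := sat_tensor.1 h₂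
      exact sat_tensor.2 ⟨sat_comp_of_inj (Option.some_injective _) h₃ h₄,
        sat_comp_of_inj (Option.some_injective _) h₃' h₄'⟩
  tensor_assoc R S T := ext_sat fun Z a b => by
    rw [sat_castHom]
    simp only [sat_tensor, Wiring.cast_natAdd, Wiring.cast_castAdd_castAdd,
      Wiring.cast_castAdd_natAdd, and_assoc]
  zero_tensor R := ext_sat fun Z a b => by
    rw [sat_castHom, sat_tensor, sat_ofEquiv]
    simp only [Wiring.cast_natAdd_zero]
    exact ⟨fun h => h.2, fun h => ⟨fun i => i.elim0, h⟩⟩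
  tensor_zero R := ext_sat fun Z a b => by
    rw [sat_castHom, sat_tensor, sat_ofEquiv]
    exact ⟨fun h => h.1, fun h => ⟨h, fun i => i.elim0⟩⟩
  symm_natural R S := ext_sat fun Z a b => by
    rw [sat_comp_ofEquiv, sat_ofEquiv_comp, sat_tensor, sat_tensor]
    have h₁ : ∀ {k l : ℕ} (i : Fin l), (finAddFlip (m := k) (n := l)).symm (Fin.castAdd k i) =
        Fin.natAdd k i := fun i => (Equiv.symm_apply_eq _).2 (finAddFlip_apply_natAdd i _).symm
    have h₂ : ∀ {k l : ℕ} (i : Fin k), (finAddFlip (m := k) (n := l)).symm (Fin.natAdd l i) =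
        Fin.castAdd l i := fun i => (Equiv.symm_apply_eq _).2 (finAddFlip_apply_castAdd i _).symm
    simp only [h₁, h₂, finAddFlip_apply_castAdd, finAddFlip_apply_natAdd]
    exact and_comm
  symm_symm m n := ext_sat fun Z a b => by
    rw [sat_comp_ofEquiv, sat_ofEquiv, sat_ofEquiv]
    refine forall_congr' fun i => ?_
    have : finAddFlip (finAddFlip i) = i := by
      induction i using Fin.addCases <;> simp
    rw [this]
    rfl
  symm_hexagon m n p := by
    have k := castHom_ofEquiv rfl (Nat.add_assoc n m p) ((finSumFinEquiv.symm.trans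
      (Equiv.sumCongr (finAddFlip (m := m) (n := n)) (Equiv.refl (Fin p)))).trans finSumFinEquiv)
    rw [castHom_ofEquiv, tensor_ofEquiv, tensor_ofEquiv, k, ofEquiv_comp_ofEquiv]
    congr 1
    ext1 i
    exact Wiring.finAddFlip_hexagon i

/-- The defining condition of `FinCorel°`: (a) every equivalence class contains exactly one input
element, and (b) every equivalence class contains at least one output element. -/
def Corel.IsCirc {m n : ℕ} (R : Corel m n) : Prop :=
  (∀ c ∈ R.classes, ∃! i : Fin m, inl i ∈ c) ∧ (∀ c ∈ R.classes, ∃ j : Fin n, inr j ∈ c)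

/-! ### The ancestry partition -/

namespace Diagram

variable {m n : ℕ}

/-- The node of the underlying undirected graph at which a wire starts: an input pendant vertex or
an internal vertex. -/
def srcNode (G : Diagram m n) : Fin m ⊕ G.V × Bool → (Fin m ⊕ Fin n) ⊕ G.V
  | inl i => inl (inl i)
  | inr (v, _) => inr v

/-- The node of the underlying undirected graph at which a wire ends: an output pendant vertex or
an internal vertex. -/
def tgtNode (G : Diagram m n) : Fin n ⊕ G.V → (Fin m ⊕ Fin n) ⊕ G.V
  | inl j => inl (inr j)
  | inr v => inr v

/-- The underlying undirected graph `|G|`, whose nodes are the inputs and outputs (as pendant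
vertices) and the internal vertices, and whose edges are the wires. -/
def underlying (G : Diagram m n) : SimpleGraph ((Fin m ⊕ Fin n) ⊕ G.V) :=
  SimpleGraph.fromRel fun x y => ∃ s, G.srcNode s = x ∧ G.tgtNode (G.wire s) = y

/-- The ancestry partition: two boundary elements are equivalent if their pendant vertices lie in
the same connected component of the underlying undirected graph. -/
@[reducible] def ancestry (G : Diagram m n) : Corel m n :=
  G.underlying.reachableSetoid.comap inl

theorem Iso.ancestry_le {G H : Diagram m n} (h : Iso G H) : G.ancestry ≤ H.ancestry := by
  obtain ⟨φ, h₁, h₂⟩ := h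
  let F : (Fin m ⊕ Fin n) ⊕ G.V → (Fin m ⊕ Fin n) ⊕ H.V := Sum.map id φ
  have hF : Function.Injective F := Function.injective_id.sumMap φ.injective
  have hr : ∀ x y, (∃ s, G.srcNode s = x ∧ G.tgtNode (G.wire s) = y) →
      ∃ s, H.srcNode s = F x ∧ H.tgtNode (H.wire s) = F y := by
    rintro _ _ ⟨i | ⟨v, s⟩, rfl, rfl⟩
    · refine ⟨inl i, rfl, ?_⟩
      rw [h₁]
      rcases G.wire (inl i) with j | v <;> rfl
    · refine ⟨inr (φ v, s), rfl, ?_⟩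
      rw [h₂]
      rcases G.wire (inr (v, s)) with j | v <;> rfl
  let f : G.underlying →g H.underlying :=
    { toFun := F
      map_rel' := fun {x y} hxy => by
        obtain ⟨hne, hxy⟩ := (SimpleGraph.fromRel_adj _ _ _).1 hxy
        exact (SimpleGraph.fromRel_adj _ _ _).2 ⟨hF.ne hne, hxy.imp (hr _ _) (hr _ _)⟩ }
  intro x y hxy
  exact SimpleGraph.Reachable.map f hxy

theorem Iso.ancestry_eq {G H : Diagram m n} (h : Iso G H) : G.ancestry = H.ancestry :=
  le_antisymm h.ancestry_le (Iso.ancestry_le ((isoSetoid m n).symm h))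

end Diagram

/-- The ancestry partition of a morphism of `Syn(δ)`. -/
def ancestry {m n : ℕ} (f : Syn.Hom m n) : FinCorel.Hom m n :=
  Quotient.lift Diagram.ancestry (fun _ _ h => Diagram.Iso.ancestry_eq h) f

/-! ### The PROP `Cocom` -/

/-- Formal composites and tensors of identities, symmetries and one generator `δ : 1 → 2`. -/
inductive Term : ℕ → ℕ → Type
  | id (n : ℕ) : Term n n
  | comp {m n p : ℕ} (f : Term m n) (g : Term n p) : Term m p
  | tensor {m n m' n' : ℕ} (f : Term m n) (g : Term m' n') : Term (m + m') (n + n')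
  | symm (m n : ℕ) : Term (m + n) (n + m)
  | delta : Term 1 2

/-- The least congruence on terms which contains the axioms of a PROP, coassociativity and
cocommutativity of `δ`. -/
inductive CocomRel : ∀ {m n : ℕ}, Term m n → Term m n → Prop
  | refl {m n : ℕ} (f : Term m n) : CocomRel f f
  | symm {m n : ℕ} {f g : Term m n} : CocomRel f g → CocomRel g f
  | trans {m n : ℕ} {f g h : Term m n} : CocomRel f g → CocomRel g h → CocomRel f h
  | comp_congr {m n p : ℕ} {f f' : Term m n} {g g' : Term n p} :
    CocomRel f f' → CocomRel g g' → CocomRel (f.comp g) (f'.comp g')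
  | tensor_congr {m n m' n' : ℕ} {f f' : Term m n} {g g' : Term m' n'} :
    CocomRel f f' → CocomRel g g' → CocomRel (f.tensor g) (f'.tensor g')
  | id_comp {m n : ℕ} (f : Term m n) : CocomRel ((Term.id m).comp f) f
  | comp_id {m n : ℕ} (f : Term m n) : CocomRel (f.comp (Term.id n)) f
  | comp_assoc {m n p q : ℕ} (f : Term m n) (g : Term n p) (h : Term p q) :
    CocomRel ((f.comp g).comp h) (f.comp (g.comp h))
  | tensor_id (m n : ℕ) : CocomRel ((Term.id m).tensor (Term.id n)) (Term.id (m + n))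
  | tensor_comp {m n p m' n' p' : ℕ} (f : Term m n) (g : Term n p) (f' : Term m' n')
    (g' : Term n' p') :
    CocomRel ((f.comp g).tensor (f'.comp g')) ((f.tensor f').comp (g.tensor g'))
  | tensor_assoc {m n m' n' m'' n'' : ℕ} (f : Term m n) (g : Term m' n') (h : Term m'' n'') :
    CocomRel (castHom (Nat.add_assoc m m' m'') (Nat.add_assoc n n' n'')
      ((f.tensor g).tensor h)) (f.tensor (g.tensor h))
  | zero_tensor {m n : ℕ} (f : Term m n) :
    CocomRel (castHom (Nat.zero_add m) (Nat.zero_add n) ((Term.id 0).tensor f)) f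
  | tensor_zero {m n : ℕ} (f : Term m n) :
    CocomRel (castHom (Nat.add_zero m) (Nat.add_zero n) (f.tensor (Term.id 0))) f
  | symm_natural {m n m' n' : ℕ} (f : Term m n) (g : Term m' n') :
    CocomRel ((f.tensor g).comp (Term.symm n n')) ((Term.symm m m').comp (g.tensor f))
  | symm_symm (m n : ℕ) :
    CocomRel ((Term.symm m n).comp (Term.symm n m)) (Term.id (m + n))
  | symm_hexagon (m n p : ℕ) :
    CocomRel (castHom (Nat.add_assoc m n p).symm (Nat.add_assoc n p m) (Term.symm m (n + p)))
      ((castHom rfl (Nat.add_assoc n m p) ((Term.symm m n).tensor (Term.id p))).comp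
        ((Term.id n).tensor (Term.symm m p)))
  | coassoc : CocomRel (Term.delta.comp (Term.delta.tensor (Term.id 1)))
      (Term.delta.comp ((Term.id 1).tensor Term.delta))
  | cocomm : CocomRel (Term.delta.comp (Term.symm 1 1)) Term.delta

/-- Provable equality of terms, as an equivalence relation. -/
def cocomSetoid (m n : ℕ) : Setoid (Term m n) where
  r := CocomRel
  iseqv := ⟨.refl, .symm, .trans⟩

theorem castHom_mk_term {m n m' n' : ℕ} (hm : m = m') (hn : n = n') (f : Term m n) :
    castHom (H := fun m n => Quotient (cocomSetoid m n)) hm hn (Quotient.mk _ f) =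
      Quotient.mk _ (castHom hm hn f) := by
  subst hm hn
  rfl

/-- The PROP `Cocom` freely generated by a morphism `δ : 1 → 2` subject to coassociativity and
cocommutativity. -/
def Cocom : PROP.{0} where
  Hom m n := Quotient (cocomSetoid m n)
  id n := Quotient.mk _ (Term.id n)
  comp f g := Quotient.map₂ Term.comp (fun _ _ h _ _ k => CocomRel.comp_congr h k) f g
  tensor f g := Quotient.map₂ Term.tensor (fun _ _ h _ _ k => CocomRel.tensor_congr h k) f g
  symm m n := Quotient.mk _ (Term.symm m n)
  id_comp f := by
    induction f using Quotient.ind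
    exact Quotient.sound (CocomRel.id_comp _)
  comp_id f := by
    induction f using Quotient.ind
    exact Quotient.sound (CocomRel.comp_id _)
  comp_assoc f g h := by
    induction f using Quotient.ind
    induction g using Quotient.ind
    induction h using Quotient.ind
    exact Quotient.sound (CocomRel.comp_assoc _ _ _)
  tensor_id m n := Quotient.sound (CocomRel.tensor_id m n)
  tensor_comp f g f' g' := by
    induction f using Quotient.ind
    induction g using Quotient.ind
    induction f' using Quotient.ind
    induction g' using Quotient.ind
    exact Quotient.sound (CocomRel.tensor_comp _ _ _ _)
  tensor_assoc f g h := by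
    induction f using Quotient.ind
    induction g using Quotient.ind
    induction h using Quotient.ind
    exact (castHom_mk_term _ _ _).trans (Quotient.sound (CocomRel.tensor_assoc _ _ _))
  zero_tensor f := by
    induction f using Quotient.ind
    exact (castHom_mk_term _ _ _).trans (Quotient.sound (CocomRel.zero_tensor _))
  tensor_zero f := by
    induction f using Quotient.ind
    exact (castHom_mk_term _ _ _).trans (Quotient.sound (CocomRel.tensor_zero _))
  symm_natural f g := by
    induction f using Quotient.ind
    induction g using Quotient.ind
    exact Quotient.sound (CocomRel.symm_natural _ _)
  symm_symm m n := Quotient.sound (CocomRel.symm_symm m n)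
  symm_hexagon m n p := by
    have k := castHom_mk_term rfl (Nat.add_assoc n m p) ((Term.symm m n).tensor (Term.id p))
    refine (castHom_mk_term _ _ _).trans ((Quotient.sound (CocomRel.symm_hexagon m n p)).trans ?_)
    exact congrArg (fun z => Quotient.map₂ Term.comp
      (fun _ _ h _ _ k => CocomRel.comp_congr h k) z
      (Quotient.mk _ ((Term.id n).tensor (Term.symm m p)))) k.symm

/-- The generator `δ : 1 → 2` of `Cocom`. -/
def Cocom.delta : Cocom.Hom 1 2 := Quotient.mk _ Term.delta

/-! ### The PROP of surjections -/

theorem castHom_surj {m n m' n' : ℕ} (hm : m = m') (hn : n = n')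
    (φ : {φ : Fin n → Fin m // Function.Surjective φ}) (j : Fin n') :
    (castHom (H := fun m n => {φ : Fin n → Fin m // Function.Surjective φ}) hm hn φ).1 j =
      Fin.cast hm (φ.1 (Fin.cast hn.symm j)) := by
  subst hm hn
  rfl

/-- The tensor of two functions between finite ordinals. -/
def finSumMap {m n m' n' : ℕ} (φ : Fin n → Fin m) (ψ : Fin n' → Fin m') :
    Fin (n + n') → Fin (m + m') :=
  finSumFinEquiv ∘ Sum.map φ ψ ∘ finSumFinEquiv.symm

theorem finSumMap_castAdd {m n m' n' : ℕ} (φ : Fin n → Fin m) (ψ : Fin n' → Fin m')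
    (j : Fin n) : finSumMap φ ψ (Fin.castAdd n' j) = Fin.castAdd m' (φ j) := by
  simp [finSumMap]

theorem finSumMap_natAdd {m n m' n' : ℕ} (φ : Fin n → Fin m) (ψ : Fin n' → Fin m')
    (j : Fin n') : finSumMap φ ψ (Fin.natAdd n j) = Fin.natAdd m (ψ j) := by
  simp [finSumMap]

theorem finSumMap_surjective {m n m' n' : ℕ} {φ : Fin n → Fin m} {ψ : Fin n' → Fin m'}
    (hφ : Function.Surjective φ) (hψ : Function.Surjective ψ) :
    Function.Surjective (finSumMap φ ψ) :=
  finSumFinEquiv.surjective.comp ((hφ.sumMap hψ).comp finSumFinEquiv.symm.surjective)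

theorem surj_hexagon (m n p : ℕ) (j : Fin (n + p + m)) :
    Fin.cast (Nat.add_assoc m n p).symm (finAddFlip j) =
      finSumMap finAddFlip id (Fin.cast (Nat.add_assoc n m p).symm
        (finSumMap id finAddFlip (Fin.cast (Nat.add_assoc n p m) j))) := by
  have h₁ : ∀ {a b c : ℕ} (i : Fin a), Fin.cast (Nat.add_assoc a b c).symm
      (Fin.castAdd (b + c) i) = Fin.castAdd c (Fin.castAdd b i) := fun _ => rfl
  have h₂ : ∀ {a b c : ℕ} (i : Fin b), Fin.cast (Nat.add_assoc a b c).symm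
      (Fin.natAdd a (Fin.castAdd c i)) = Fin.castAdd c (Fin.natAdd a i) := fun _ => rfl
  have h₃ : ∀ {a b c : ℕ} (i : Fin c), Fin.cast (Nat.add_assoc a b c).symm
      (Fin.natAdd a (Fin.natAdd b i)) = Fin.natAdd (a + b) i :=
    fun _ => Fin.ext (Nat.add_assoc _ _ _).symm
  induction j using Fin.addCases with
  | left j =>
    induction j using Fin.addCases with
    | left j =>
      rw [Wiring.cast_castAdd_castAdd, finAddFlip_apply_castAdd, h₂, finSumMap_castAdd, id, h₁,
        finSumMap_castAdd, finAddFlip_apply_castAdd]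
    | right j =>
      rw [Wiring.cast_castAdd_natAdd, finAddFlip_apply_castAdd, h₃, finSumMap_natAdd,
        finAddFlip_apply_castAdd, h₃, finSumMap_natAdd, id]
  | right j =>
    rw [Wiring.cast_natAdd, finAddFlip_apply_natAdd, h₁, finSumMap_natAdd,
      finAddFlip_apply_natAdd, h₂, finSumMap_castAdd, finAddFlip_apply_natAdd]

/-- The PROP whose morphisms `m → n` are the surjections `{1, …, n} → {1, …, m}`, composed as
functions, with disjoint union as tensor. -/
def SurjOp : PROP.{0} where
  Hom m n := {φ : Fin n → Fin m // Function.Surjective φ}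
  id n := ⟨id, Function.surjective_id⟩
  comp f g := ⟨f.1 ∘ g.1, f.2.comp g.2⟩
  tensor f g := ⟨finSumMap f.1 g.1, finSumMap_surjective f.2 g.2⟩
  symm m n := ⟨finAddFlip, finAddFlip.surjective⟩
  id_comp f := rfl
  comp_id f := rfl
  comp_assoc f g h := rfl
  tensor_id m n := Subtype.ext <| funext fun j => by
    induction j using Fin.addCases <;> simp [finSumMap_castAdd, finSumMap_natAdd]
  tensor_comp f g f' g' := Subtype.ext <| funext fun j => by
    induction j using Fin.addCases <;> simp [finSumMap_castAdd, finSumMap_natAdd]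
  tensor_assoc {m n m' n' m'' n''} f g h := Subtype.ext <| funext fun j => by
    rw [castHom_surj]
    obtain ⟨j, rfl⟩ : ∃ i, j = Fin.cast (Nat.add_assoc n n' n'') i :=
      ⟨Fin.cast (by omega) j, rfl⟩
    rw [Fin.cast_cast, Fin.cast_eq_self]
    induction j using Fin.addCases with
    | left j =>
      induction j using Fin.addCases with
      | left j =>
        rw [Wiring.cast_castAdd_castAdd]
        simp only [finSumMap_castAdd, Wiring.cast_castAdd_castAdd]
      | right j =>
        rw [Wiring.cast_castAdd_natAdd]
        simp only [finSumMap_castAdd, finSumMap_natAdd, Wiring.cast_castAdd_natAdd]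
    | right j =>
      rw [Wiring.cast_natAdd]
      simp only [finSumMap_natAdd, Wiring.cast_natAdd]
  zero_tensor {m n} f := Subtype.ext <| funext fun j => by
    rw [castHom_surj]
    obtain ⟨j, rfl⟩ : ∃ i, j = Fin.cast (Nat.zero_add n) i :=
      ⟨Fin.cast (by omega) j, rfl⟩
    rw [Fin.cast_cast, Fin.cast_eq_self]
    induction j using Fin.addCases with
    | left j => exact j.elim0
    | right j =>
      dsimp only
      rw [finSumMap_natAdd, Wiring.cast_natAdd_zero, Wiring.cast_natAdd_zero]
  tensor_zero f := Subtype.ext <| funext fun j => finSumMap_castAdd f.1 id j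
  symm_natural f g := Subtype.ext <| funext fun j => by
    induction j using Fin.addCases <;> simp [finSumMap_castAdd, finSumMap_natAdd]
  symm_symm m n := Subtype.ext <| funext fun j => by
    induction j using Fin.addCases <;> simp
  symm_hexagon m n p := Subtype.ext <| funext fun j => by
    rw [castHom_surj]
    obtain ⟨j, rfl⟩ : ∃ i, j = Fin.cast (Nat.add_assoc n p m) i :=
      ⟨Fin.cast (by omega) j, rfl⟩
    rw [Fin.cast_cast, Fin.cast_eq_self]
    refine (surj_hexagon m n p j).trans (congrArg (fun z => z) ?_)
    exact (castHom_surj rfl (Nat.add_assoc n m p) ⟨finSumMap finAddFlip id,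
      finSumMap_surjective finAddFlip.surjective Function.surjective_id⟩ _).symm

/-- The unique function from a two-element set to a one-element set, as a morphism `1 → 2`. -/
def SurjOp.delta : SurjOp.Hom 1 2 :=
  (⟨fun _ => 0, fun i => ⟨0, (Subsingleton.elim i 0).symm⟩⟩ :
    {φ : Fin 2 → Fin 1 // Function.Surjective φ})

end AncestryPROP

open AncestryPROP

/-!
A formal composite of `δ`s can be rebuilt one output at a time, the last output first: the last
output is either a strand that is moved to the end or a copy of an earlier strand. Coassociativity,
cocommutativity and naturality of the symmetry let two outputs that are produced one after the
other exchange places, so the morphisms which have such a normal form are closed under composition,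
and every morphism of `Cocom` has one. Evaluated on surjections, normal forms enumerate every
surjection exactly once: whether the last output shares its fibre decides between copying and
moving, and its value decides which strand. So `Cocom` is the PROP of surjections.

In a diagram every vertex has a single incoming wire, so acyclicity lets one trace every vertex and
every output back to an input, its root, and a connected component consists of everything with a
given root. So `Π` sends a diagram to the corelation of the function assigning to each output its
root; since every wire also leads forward to some output, this function is a surjection. As every
surjection is realised by a normal form, the image of `Π` is a copy of the PROP of surjections.
-/

universe w

namespace AncestryPROP

open Sum PROP

local notation:80 f:81 "≫" g:80 => PROP.comp _ f g

/-! ### Calculus in a PROP -/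

namespace PROP

variable {P : PROP.{u}}

theorem castHom_comp {a b c a' b' c' : ℕ} (ha : a = a') (hb : b = b') (hc : c = c')
    (f : P.Hom a b) (g : P.Hom b c) :
    castHom ha hc (f ≫ g) = castHom ha hb f ≫ castHom hb hc g := by
  subst ha hb hc; rfl

theorem castHom_id {a a' : ℕ} (h : a = a') : castHom h h (P.id a) = P.id a' := by
  subst h; rfl

theorem castHom_castHom {a b a' b' a'' b'' : ℕ} (ha : a = a') (hb : b = b') (ha' : a' = a'')
    (hb' : b' = b'') (f : P.Hom a b) :
    castHom ha' hb' (castHom ha hb f) = castHom (ha.trans ha') (hb.trans hb') f := by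
  subst ha hb ha' hb'; rfl

theorem eq_of_comp_eq_id {m n : ℕ} {f f' : P.Hom m n} {g : P.Hom n m} :
    f ≫ g = P.id m → g ≫ f' = P.id n → f = f' := by
  intro hf hf'
  rw [← P.comp_id f, ← hf', ← P.comp_assoc, hf, P.id_comp]

theorem tensor_eq_left_right {m n m' n' : ℕ} (f : P.Hom m n) (g : P.Hom m' n') :
    P.tensor f g = P.tensor f (P.id m') ≫ P.tensor (P.id n) g := by
  rw [← P.tensor_comp, P.comp_id, P.id_comp]

theorem tensor_eq_right_left {m n m' n' : ℕ} (f : P.Hom m n) (g : P.Hom m' n') :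
    P.tensor f g = P.tensor (P.id m) g ≫ P.tensor f (P.id n') := by
  rw [← P.tensor_comp, P.comp_id, P.id_comp]

theorem id_tensor_comp {k m n p : ℕ} (f : P.Hom m n) (g : P.Hom n p) :
    P.tensor (P.id k) (f ≫ g) = P.tensor (P.id k) f ≫ P.tensor (P.id k) g := by
  rw [← P.tensor_comp, P.comp_id]

variable (P) in
/-- The morphism `f` next to one further strand, placed last. Since `n + 1` is a successor,
iterating it involves no transports. -/
def whisker {m n : ℕ} (f : P.Hom m n) : P.Hom (m + 1) (n + 1) := P.tensor f (P.id 1)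

variable (P) in
/-- The transposition of the last two strands. -/
def swapLast (n : ℕ) : P.Hom (n + 1 + 1) (n + 1 + 1) :=
  (P.tensor (P.id n) (P.symm 1 1) : P.Hom (n + (1 + 1)) (n + (1 + 1)))

/-- A morphism `1 → 2` applied to the last strand. -/
def atLast (δ : P.Hom 1 2) (n : ℕ) : P.Hom (n + 1) (n + 1 + 1) :=
  (P.tensor (P.id n) δ : P.Hom (n + 1) (n + 2))

theorem whisker_id (n : ℕ) : P.whisker (P.id n) = P.id (n + 1) := P.tensor_id n 1

theorem whisker_comp {m n p : ℕ} (f : P.Hom m n) (g : P.Hom n p) :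
    P.whisker (f ≫ g) = P.whisker f ≫ P.whisker g := by
  rw [whisker, ← P.comp_id (P.id 1), P.tensor_comp]; rfl

theorem whisker_tensor {m n m' n' : ℕ} (f : P.Hom m n) (g : P.Hom m' n') :
    P.whisker (P.tensor f g) = P.tensor f (P.whisker g) := P.tensor_assoc f g (P.id 1)

theorem whisker_whisker {m n : ℕ} (f : P.Hom m n) :
    P.whisker (P.whisker f) = P.tensor f (P.id (1 + 1)) := by
  rw [← whisker_id]
  exact whisker_tensor f (P.id 1)

theorem id_tensor_id_tensor {m n k l : ℕ} (f : P.Hom k l) :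
    castHom (Nat.add_assoc m n k) (Nat.add_assoc m n l) (P.tensor (P.id (m + n)) f) =
      P.tensor (P.id m) (P.tensor (P.id n) f) := by
  rw [← P.tensor_id, P.tensor_assoc]

theorem id_tensor_swapLast (m n : ℕ) :
    P.tensor (P.id m) (P.swapLast n) = P.swapLast (m + n) :=
  (id_tensor_id_tensor (P.symm 1 1)).symm

theorem id_tensor_atLast (δ : P.Hom 1 2) (m n : ℕ) :
    P.tensor (P.id m) (atLast δ n) = atLast δ (m + n) :=
  (id_tensor_id_tensor δ).symm

theorem swapLast_zero : P.swapLast 0 = P.symm 1 1 := P.zero_tensor (P.symm 1 1)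

theorem atLast_zero (δ : P.Hom 1 2) : atLast δ 0 = δ := P.zero_tensor δ

theorem swapLast_swapLast (n : ℕ) : P.swapLast n ≫ P.swapLast n = P.id (n + 1 + 1) := by
  have h : P.tensor (P.id n) (P.symm 1 1 ≫ P.symm 1 1) = P.id (n + 1 + 1) := by
    rw [P.symm_symm, P.tensor_id]
  rwa [id_tensor_comp] at h

theorem swapLast_swapLast_assoc {m n : ℕ} (f : P.Hom (m + 1 + 1) n) :
    P.swapLast m ≫ P.swapLast m ≫ f = f := by
  rw [← P.comp_assoc, swapLast_swapLast, P.id_comp]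

theorem swapLast_natural {m n : ℕ} (f : P.Hom m n) :
    P.whisker (P.whisker f) ≫ P.swapLast n = P.swapLast m ≫ P.whisker (P.whisker f) := by
  rw [whisker_whisker]
  exact (tensor_eq_left_right f (P.symm 1 1)).symm.trans (tensor_eq_right_left f (P.symm 1 1))

theorem atLast_natural (δ : P.Hom 1 2) {m n : ℕ} (f : P.Hom m n) :
    P.whisker f ≫ atLast δ n = atLast δ m ≫ P.whisker (P.whisker f) := by
  rw [whisker_whisker]
  exact (tensor_eq_left_right f δ).symm.trans (tensor_eq_right_left f δ)

theorem symm_succ_right (m n : ℕ) :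
    castHom rfl (Nat.add_assoc n 1 m) (P.symm m (n + 1)) =
      castHom rfl (Nat.add_assoc n m 1) (P.whisker (P.symm m n)) ≫
        P.tensor (P.id n) (P.symm m 1) := P.symm_hexagon m n 1

theorem symm_succ_left (m n : ℕ) :
    castHom (Nat.add_assoc n 1 m) rfl (P.symm (n + 1) m) =
      P.tensor (P.id n) (P.symm 1 m) ≫
        castHom (Nat.add_assoc n m 1) rfl (P.whisker (P.symm n m)) := by
  refine eq_of_comp_eq_id (g := castHom rfl (Nat.add_assoc n 1 m) (P.symm m (n + 1))) ?_ ?_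
  · rw [← castHom_comp, P.symm_symm, castHom_id]
  · rw [symm_succ_right, P.comp_assoc, ← P.comp_assoc (P.tensor (P.id n) (P.symm m 1)),
      ← id_tensor_comp, P.symm_symm, P.tensor_id, P.id_comp, ← castHom_comp, ← whisker_comp,
      P.symm_symm, whisker_id, castHom_id]

theorem symm_one_two : (P.symm 1 2 : P.Hom 3 3) = P.whisker (P.symm 1 1) ≫ P.swapLast 1 :=
  symm_succ_right (P := P) 1 1

theorem symm_two_one : (P.symm 2 1 : P.Hom 3 3) = P.swapLast 1 ≫ P.whisker (P.symm 1 1) :=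
  symm_succ_left (P := P) 1 1

theorem symm_zero_right (m : ℕ) :
    castHom (Nat.add_zero m) (Nat.zero_add m) (P.symm m 0) = P.id m := by
  set s : P.Hom m m := castHom (Nat.add_zero m) (Nat.zero_add m) (P.symm m 0)
  set t : P.Hom m m := castHom (Nat.zero_add m) (Nat.add_zero m) (P.symm 0 m)
  have inverse : s ≫ t = P.id m := by rw [← castHom_comp, P.symm_symm, castHom_id]
  have idempotent : s ≫ s = s := by
    have hexagon := congrArg (castHom (H := P.Hom) (Nat.add_zero m)
      ((Nat.zero_add _).trans (Nat.zero_add m))) (P.symm_hexagon m 0 0)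
    have right : castHom rfl (Nat.add_assoc 0 m 0) (P.tensor (P.symm m 0) (P.id 0)) =
      P.symm m 0 := P.tensor_zero (P.symm m 0)
    have left := congrArg (castHom (H := P.Hom) (Nat.add_zero m) (Nat.zero_add m))
      (P.zero_tensor (P.symm m 0))
    rw [castHom_castHom, right, castHom_comp (Nat.add_zero m) (Nat.zero_add m)] at hexagon
    rw [castHom_castHom] at left
    exact (hexagon.trans (congrArg (s ≫ ·) left)).symm
  rw [← P.comp_id s, ← inverse, ← P.comp_assoc, idempotent]

theorem symm_zero_left (m : ℕ) :
    castHom (Nat.zero_add m) (Nat.add_zero m) (P.symm 0 m) = P.id m := by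
  refine eq_of_comp_eq_id (g := castHom (Nat.add_zero m) (Nat.zero_add m) (P.symm m 0)) ?_ ?_
  · rw [← castHom_comp, P.symm_symm, castHom_id]
  · rw [symm_zero_right, P.id_comp]

theorem whisker_swapLast (n : ℕ) :
    P.whisker (P.swapLast n) = P.tensor (P.id n) (P.whisker (P.symm 1 1)) :=
  whisker_tensor (P.id n) (P.symm 1 1)

theorem whisker_atLast (δ : P.Hom 1 2) (n : ℕ) :
    P.whisker (atLast δ n) = P.tensor (P.id n) (P.whisker δ) :=
  whisker_tensor (P.id n) δ

theorem swapLast_braid (n : ℕ) :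
    P.swapLast (n + 1) ≫ P.whisker (P.swapLast n) ≫ P.swapLast (n + 1) =
      P.whisker (P.swapLast n) ≫ P.swapLast (n + 1) ≫ P.whisker (P.swapLast n) := by
  have braid : P.swapLast 1 ≫ P.whisker (P.symm 1 1) ≫ P.swapLast 1 =
      P.whisker (P.symm 1 1) ≫ P.swapLast 1 ≫ P.whisker (P.symm 1 1) := by
    have h : P.swapLast 1 ≫ (P.symm 1 2 : P.Hom 3 3) =
      (P.symm 1 2 : P.Hom 3 3) ≫ P.whisker (P.symm 1 1) := P.symm_natural (P.id 1) (P.symm 1 1)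
    rwa [symm_one_two, P.comp_assoc] at h
  have h := congrArg (P.tensor (P.id n)) braid
  simp only [id_tensor_comp, ← whisker_swapLast, id_tensor_swapLast] at h
  exact h

theorem swapLast_atLast (δ : P.Hom 1 2) (n : ℕ) :
    P.swapLast n ≫ atLast δ (n + 1) =
      P.whisker (atLast δ n) ≫ P.swapLast (n + 1) ≫ P.whisker (P.swapLast n) := by
  have natural : P.whisker δ ≫ (P.symm 2 1 : P.Hom 3 3) = P.symm 1 1 ≫ atLast δ 1 :=
    P.symm_natural δ (P.id 1)
  have h := congrArg (P.tensor (P.id n)) natural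
  rw [symm_two_one] at h
  simp only [id_tensor_comp, id_tensor_swapLast, id_tensor_atLast, ← whisker_swapLast,
    ← whisker_atLast] at h
  exact h.symm

theorem swapLast_whisker_atLast (δ : P.Hom 1 2) (n : ℕ) :
    P.swapLast n ≫ P.whisker (atLast δ n) =
      atLast δ (n + 1) ≫ P.whisker (P.swapLast n) ≫ P.swapLast (n + 1) := by
  have cancel : P.whisker (P.swapLast n) ≫ P.whisker (P.swapLast n) ≫ P.swapLast (n + 1) =
      P.swapLast (n + 1) := by
    rw [← P.comp_assoc, ← whisker_comp, swapLast_swapLast, whisker_id, P.id_comp]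
  have h := congrArg (P.swapLast n ≫ · ≫ P.whisker (P.swapLast n) ≫ P.swapLast (n + 1))
    (swapLast_atLast δ n)
  simp only [P.comp_assoc, swapLast_swapLast_assoc, cancel, swapLast_swapLast, P.comp_id] at h
  exact h.symm

/-- Cocommutative coassociative comultiplications on the object `1`: the morphisms `δ : 1 → 2`
satisfying the relations that define `Cocom`. -/
structure IsCocom (δ : P.Hom 1 2) : Prop where
  coassoc : δ ≫ (P.tensor δ (P.id 1) : P.Hom 2 3) = δ ≫ (P.tensor (P.id 1) δ : P.Hom 2 3)
  cocomm : δ ≫ (P.symm 1 1 : P.Hom 2 2) = δ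

namespace IsCocom

variable {δ : P.Hom 1 2}

theorem atLast_coassoc (hδ : IsCocom δ) (n : ℕ) :
    atLast δ n ≫ atLast δ (n + 1) = atLast δ n ≫ P.whisker (atLast δ n) := by
  have h := congrArg (P.tensor (P.id n)) hδ.coassoc
  rw [id_tensor_comp, id_tensor_comp] at h
  rw [whisker_atLast, ← id_tensor_atLast]
  exact h.symm

theorem atLast_cocomm (hδ : IsCocom δ) (n : ℕ) : atLast δ n ≫ P.swapLast n = atLast δ n := by
  have h := congrArg (P.tensor (P.id n)) hδ.cocomm
  rwa [id_tensor_comp] at h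

end IsCocom

end PROP

/-! ### Normal forms -/

section NormalForms

variable {P : PROP.{u}} {δ : P.Hom 1 2}

/-- Codes for the ways to produce a new last strand out of `a` strands, leaving `b` strands in
their order: the last strand is taken away (`move`) or copied (`split`), or this is done to an
earlier strand (`succ`). -/
inductive Extraction : ℕ → ℕ → Type
  | move (b : ℕ) : Extraction (b + 1) b
  | split (b : ℕ) : Extraction (b + 1) (b + 1)
  | succ {a b : ℕ} : Extraction a b → Extraction (a + 1) (b + 1)

namespace Extraction

/-- The morphism encoded by an extraction, with `δ` as the copying operation. -/
def eval (δ : P.Hom 1 2) : ∀ {a b : ℕ}, Extraction a b → P.Hom a (b + 1)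
  | _, _, move b => P.id (b + 1)
  | _, _, split b => atLast δ b
  | _, _, succ (b := b) x => P.whisker (x.eval δ) ≫ P.swapLast b

/-- The extraction copying the strand which a given extraction moves or copies. -/
def dup : ∀ {a b : ℕ}, Extraction a b → Extraction a a
  | _, _, move b => split b
  | _, _, split b => split b
  | _, _, succ x => succ x.dup

/-- The extraction applied to the last `a` of `m + a` strands. -/
def shift (m : ℕ) : ∀ {a b : ℕ}, Extraction a b → Extraction (m + a) (m + b)
  | _, _, move b => move (m + b)
  | _, _, split b => split (m + b)
  | _, _, succ x => succ (x.shift m)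

theorem eval_shift (m : ℕ) {a b : ℕ} (x : Extraction a b) :
    (x.shift m).eval δ = P.tensor (P.id m) (x.eval δ) := by
  induction x with
  | move b => exact (P.tensor_id m (b + 1)).symm
  | split b => exact (id_tensor_atLast δ m b).symm
  | succ x ih =>
    rw [eval, id_tensor_comp, id_tensor_swapLast, ← whisker_tensor, ← ih]
    rfl

theorem eval_comp_atLast (hδ : IsCocom δ) {a b : ℕ} (x : Extraction a b) :
    x.eval δ ≫ atLast δ b = x.dup.eval δ ≫ P.whisker (x.eval δ) := by
  induction x with
  | move b => simp only [dup, eval, P.id_comp, whisker_id, P.comp_id]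
  | split b => exact hδ.atLast_coassoc b
  | @succ a b x ih =>
    calc (P.whisker (x.eval δ) ≫ P.swapLast b) ≫ atLast δ (b + 1)
        = P.whisker (x.eval δ ≫ atLast δ b) ≫ P.swapLast (b + 1) ≫ P.whisker (P.swapLast b) := by
          rw [P.comp_assoc, swapLast_atLast, whisker_comp, P.comp_assoc]
      _ = (P.whisker (x.dup.eval δ) ≫ P.swapLast a) ≫
            P.whisker (P.whisker (x.eval δ) ≫ P.swapLast b) := by
          rw [ih, whisker_comp, whisker_comp, P.comp_assoc, P.comp_assoc,
            ← P.comp_assoc (P.swapLast a), ← swapLast_natural, P.comp_assoc]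

theorem split_exchange_succ {b c : ℕ} (y : Extraction b c) :
    atLast δ b ≫ P.whisker (y.succ.eval δ) ≫ P.swapLast (c + 1) =
      y.succ.eval δ ≫ P.whisker (atLast δ c) := by
  rw [eval, P.comp_assoc, swapLast_whisker_atLast, ← P.comp_assoc (P.whisker _), atLast_natural,
    whisker_comp, P.comp_assoc, P.comp_assoc]

theorem succ_exchange_split {a b : ℕ} (x : Extraction a b) :
    x.succ.eval δ ≫ P.whisker (atLast δ b) ≫ P.swapLast (b + 1) =
      atLast δ a ≫ P.whisker (x.succ.eval δ) := by
  rw [← P.comp_assoc, ← split_exchange_succ, P.comp_assoc, P.comp_assoc, swapLast_swapLast,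
    P.comp_id]

theorem succ_exchange_succ {a b b' c : ℕ} {x : Extraction a b} {y : Extraction b c}
    {y' : Extraction a b'} {x' : Extraction b' c} :
    x.eval δ ≫ P.whisker (y.eval δ) ≫ P.swapLast c = y'.eval δ ≫ P.whisker (x'.eval δ) →
      x.succ.eval δ ≫ P.whisker (y.succ.eval δ) ≫ P.swapLast (c + 1) =
        y'.succ.eval δ ≫ P.whisker (x'.succ.eval δ) := by
  intro h
  calc (P.whisker (x.eval δ) ≫ P.swapLast b) ≫
        P.whisker (P.whisker (y.eval δ) ≫ P.swapLast c) ≫ P.swapLast (c + 1)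
      = P.whisker (x.eval δ) ≫ P.whisker (P.whisker (y.eval δ)) ≫
          P.swapLast (c + 1) ≫ P.whisker (P.swapLast c) ≫ P.swapLast (c + 1) := by
        rw [whisker_comp, P.comp_assoc, P.comp_assoc, ← P.comp_assoc (P.swapLast b),
          ← swapLast_natural, P.comp_assoc]
    _ = P.whisker (x.eval δ ≫ P.whisker (y.eval δ) ≫ P.swapLast c) ≫
          P.swapLast (c + 1) ≫ P.whisker (P.swapLast c) := by
        rw [swapLast_braid, whisker_comp, whisker_comp, P.comp_assoc, P.comp_assoc]
    _ = (P.whisker (y'.eval δ) ≫ P.swapLast b') ≫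
          P.whisker (P.whisker (x'.eval δ) ≫ P.swapLast c) := by
        rw [h, whisker_comp, whisker_comp, P.comp_assoc, P.comp_assoc,
          ← P.comp_assoc (P.swapLast b'), ← swapLast_natural, P.comp_assoc]

theorem exchange (hδ : IsCocom δ) {a b c : ℕ} (x : Extraction a b) (y : Extraction b c) :
    ∃ (b' : ℕ) (y' : Extraction a b') (x' : Extraction b' c),
      x.eval δ ≫ P.whisker (y.eval δ) ≫ P.swapLast c = y'.eval δ ≫ P.whisker (x'.eval δ) := by
  induction x generalizing c with
  | move b => exact ⟨_, succ y, move c, by simp only [eval, P.id_comp, whisker_id, P.comp_id]⟩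
  | split b =>
    cases y with
    | move b => exact ⟨_, split b, move b, by
        simp only [eval, whisker_id, P.id_comp, P.comp_id, hδ.atLast_cocomm]⟩
    | split b => exact ⟨_, split b, split b, by
        simp only [eval, ← P.comp_assoc, ← hδ.atLast_coassoc]
        rw [P.comp_assoc, hδ.atLast_cocomm]⟩
    | succ y => exact ⟨_, succ y, split _, split_exchange_succ y⟩
  | @succ a b x ih =>
    cases y with
    | move b => exact ⟨_, move a, x, by
        simp only [eval, whisker_id, P.id_comp, P.comp_assoc, swapLast_swapLast, P.comp_id]⟩
    | split b => exact ⟨_, split a, succ x, succ_exchange_split x⟩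
    | succ y =>
      obtain ⟨b', y', x', h⟩ := ih y
      exact ⟨_, succ y', succ x', succ_exchange_succ h⟩

end Extraction

/-- Codes for morphisms built from `δ` by producing the outputs one at a time, the last output
being produced first. -/
inductive NormalForm : ℕ → ℕ → Type
  | nil : NormalForm 0 0
  | cons {a b n : ℕ} : Extraction a b → NormalForm b n → NormalForm a (n + 1)

/-- The morphism encoded by a normal form. -/
def NormalForm.eval (δ : P.Hom 1 2) : ∀ {m n : ℕ}, NormalForm m n → P.Hom m n
  | _, _, nil => P.id 0
  | _, _, cons x N => x.eval δ ≫ P.whisker (N.eval δ)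

variable (δ) in
/-- The morphisms which have a normal form with respect to `δ`. -/
def IsNormal {m n : ℕ} (f : P.Hom m n) : Prop := ∃ N : NormalForm m n, N.eval δ = f

namespace NormalForm

open Extraction

theorem exists_eval_comp_extraction (hδ : IsCocom δ) {m n b : ℕ} (N : NormalForm m n)
    (z : Extraction n b) : ∃ (b' : ℕ) (z' : Extraction m b') (N' : NormalForm b' b),
      N.eval δ ≫ z.eval δ = z'.eval δ ≫ P.whisker (N'.eval δ) := by
  induction N generalizing b with
  | nil => nomatch z
  | @cons m k n x N ih =>
    cases z with
    | move => exact ⟨_, x, N, P.comp_id _⟩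
    | split => exact ⟨_, x.dup, cons x N, by
        rw [eval, Extraction.eval, P.comp_assoc, atLast_natural, ← P.comp_assoc,
          eval_comp_atLast hδ, whisker_comp, P.comp_assoc]⟩
    | @succ _ b z =>
      obtain ⟨k', z', N', hz⟩ := ih z
      obtain ⟨m', y, x', hx⟩ := x.exchange hδ z'
      refine ⟨m', y, cons x' N', ?_⟩
      calc (x.eval δ ≫ P.whisker (N.eval δ)) ≫ P.whisker (z.eval δ) ≫ P.swapLast b
          = x.eval δ ≫ P.whisker (N.eval δ ≫ z.eval δ) ≫ P.swapLast b := by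
            rw [whisker_comp, P.comp_assoc, P.comp_assoc]
        _ = (x.eval δ ≫ P.whisker (z'.eval δ) ≫ P.swapLast k') ≫
              P.whisker (P.whisker (N'.eval δ)) := by
            rw [hz, whisker_comp, P.comp_assoc, swapLast_natural, P.comp_assoc, P.comp_assoc]
        _ = y.eval δ ≫ P.whisker (x'.eval δ ≫ P.whisker (N'.eval δ)) := by
            rw [hx, whisker_comp, P.comp_assoc]

end NormalForm

namespace IsNormal

open NormalForm

theorem castHom_iff {m n m' n' : ℕ} (hm : m = m') (hn : n = n') {f : P.Hom m n} :
    IsNormal δ (castHom hm hn f) ↔ IsNormal δ f := by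
  subst hm hn; rfl

theorem whisker {m n : ℕ} {f : P.Hom m n} : IsNormal δ f → IsNormal δ (P.whisker f)
  | ⟨N, hN⟩ => ⟨cons (.move m) N, (P.id_comp _).trans (congrArg P.whisker hN)⟩

theorem id (n : ℕ) : IsNormal δ (P.id n) := by
  induction n with
  | zero => exact ⟨nil, rfl⟩
  | succ n ih => exact whisker_id (P := P) n ▸ ih.whisker

theorem extraction {a b : ℕ} (x : Extraction a b) : IsNormal δ (x.eval δ) := by
  obtain ⟨N, hN⟩ := IsNormal.id (δ := δ) b
  exact ⟨cons x N, by rw [eval, hN, whisker_id, P.comp_id]⟩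

theorem comp (hδ : IsCocom δ) {m n p : ℕ} {f : P.Hom m n} {g : P.Hom n p} :
    IsNormal δ f → IsNormal δ g → IsNormal δ (f ≫ g) := by
  rintro ⟨M, rfl⟩ ⟨N, rfl⟩
  induction N generalizing m with
  | nil => exact ⟨M, (P.comp_id _).symm⟩
  | cons z N ih =>
    obtain ⟨k, z', M', h⟩ := M.exists_eval_comp_extraction hδ z
    obtain ⟨N', hN'⟩ := ih M'
    refine ⟨cons z' N', ?_⟩
    rw [eval, hN', whisker_comp, ← P.comp_assoc, ← h, P.comp_assoc, eval]

theorem id_tensor (k : ℕ) {m n : ℕ} {f : P.Hom m n} : IsNormal δ f →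
    IsNormal δ (P.tensor (P.id k) f) := by
  rintro ⟨N, rfl⟩
  induction N with
  | nil =>
    rw [eval, P.tensor_id]
    exact .id (k + 0)
  | cons x N ih =>
    obtain ⟨M, hM⟩ := ih
    refine ⟨cons (x.shift k) M, ?_⟩
    rw [eval, eval, id_tensor_comp, ← whisker_tensor, ← hM, Extraction.eval_shift]

theorem tensor_id (k : ℕ) {m n : ℕ} {f : P.Hom m n} (hf : IsNormal δ f) :
    IsNormal δ (P.tensor f (P.id k)) := by
  induction k with
  | zero => exact (castHom_iff (Nat.add_zero m) (Nat.add_zero n)).1 (by rwa [P.tensor_zero])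
  | succ k ih =>
    rw [← whisker_id, ← whisker_tensor]
    exact ih.whisker

theorem tensor (hδ : IsCocom δ) {m n m' n' : ℕ} {f : P.Hom m n} {g : P.Hom m' n'}
    (hf : IsNormal δ f) (hg : IsNormal δ g) : IsNormal δ (P.tensor f g) := by
  rw [tensor_eq_left_right]
  exact comp hδ (hf.tensor_id m') (hg.id_tensor n)

theorem delta : IsNormal δ δ := by
  have h := extraction (δ := δ) (.split 0)
  rwa [Extraction.eval, atLast_zero] at h

theorem symm_one_one : IsNormal δ (P.symm 1 1) := by
  have h := extraction (δ := δ) (.succ (.move 0))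
  rwa [Extraction.eval, Extraction.eval, whisker_id, P.id_comp, swapLast_zero] at h

theorem symm_one (hδ : IsCocom δ) (n : ℕ) : IsNormal δ (P.symm 1 n) := by
  induction n with
  | zero =>
    rw [← castHom_iff (Nat.add_zero 1) (Nat.zero_add 1), symm_zero_right]
    exact .id 1
  | succ n ih =>
    rw [← castHom_iff rfl (Nat.add_assoc n 1 1), symm_succ_right]
    exact comp hδ ((castHom_iff _ _).2 ih.whisker) (symm_one_one.id_tensor n)

theorem symm (hδ : IsCocom δ) (m n : ℕ) : IsNormal δ (P.symm m n) := by
  induction m with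
  | zero =>
    rw [← castHom_iff (Nat.zero_add n) (Nat.add_zero n), symm_zero_left]
    exact .id n
  | succ m ih =>
    rw [← castHom_iff (Nat.add_assoc m 1 n) rfl, symm_succ_left]
    exact comp hδ ((symm_one hδ n).id_tensor m) ((castHom_iff _ _).2 ih.whisker)

end IsNormal

end NormalForms

/-! ### `Cocom` and surjections -/

namespace PROPHom

variable {P : PROP.{u}} {Q : PROP.{v}} (F : PROPHom P Q)

theorem map_whisker {m n : ℕ} (f : P.Hom m n) : F.map (P.whisker f) = Q.whisker (F.map f) :=
  (F.map_tensor f (P.id 1)).trans (congrArg (Q.tensor (F.map f)) (F.map_id 1))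

theorem map_swapLast (n : ℕ) : F.map (P.swapLast n) = Q.swapLast n :=
  (F.map_tensor (P.id n) (P.symm 1 1)).trans (congrArg₂ Q.tensor (F.map_id n) (F.map_symm 1 1))

theorem map_atLast (δ : P.Hom 1 2) (n : ℕ) : F.map (atLast δ n) = atLast (F.map δ) n :=
  (F.map_tensor (P.id n) δ).trans (congrArg (Q.tensor · (F.map δ)) (F.map_id n))

theorem map_extraction_eval (δ : P.Hom 1 2) {a b : ℕ} (x : Extraction a b) :
    F.map (x.eval δ) = x.eval (F.map δ) := by
  induction x with
  | move b => exact F.map_id _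
  | split b => exact F.map_atLast δ b
  | succ x ih => simp only [Extraction.eval, F.map_comp, map_whisker, map_swapLast, ih]

theorem map_normalForm_eval (δ : P.Hom 1 2) {m n : ℕ} (N : NormalForm m n) :
    F.map (N.eval δ) = N.eval (F.map δ) := by
  induction N with
  | nil => exact F.map_id 0
  | cons x N ih => simp only [NormalForm.eval, F.map_comp, map_extraction_eval, map_whisker, ih]

end PROPHom

namespace PROP

/-- The interpretation of formal composites in a PROP with a morphism `δ : 1 → 2`. -/
def eval (P : PROP.{u}) (δ : P.Hom 1 2) : ∀ {m n : ℕ}, Term m n → P.Hom m n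
  | _, _, .id n => P.id n
  | _, _, .comp f g => P.eval δ f ≫ P.eval δ g
  | _, _, .tensor f g => P.tensor (P.eval δ f) (P.eval δ g)
  | _, _, .symm m n => P.symm m n
  | _, _, .delta => δ

theorem eval_castHom (P : PROP.{u}) (δ : P.Hom 1 2) {m n m' n' : ℕ} (hm : m = m') (hn : n = n')
    (t : Term m n) : P.eval δ (castHom hm hn t) = castHom hm hn (P.eval δ t) :=
  castHom_map (H := Term) (K := P.Hom) (P.eval δ) hm hn t

variable {P : PROP.{u}} {δ : P.Hom 1 2}

theorem IsCocom.eval_eq_of_rel (hδ : IsCocom δ) {m n : ℕ} {s t : Term m n} (h : CocomRel s t) :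
    P.eval δ s = P.eval δ t := by
  induction h with
  | refl f => rfl
  | symm _ ih => exact ih.symm
  | trans _ _ ih ih' => exact ih.trans ih'
  | comp_congr _ _ ih ih' => exact congrArg₂ P.comp ih ih'
  | tensor_congr _ _ ih ih' => exact congrArg₂ P.tensor ih ih'
  | id_comp f => exact P.id_comp _
  | comp_id f => exact P.comp_id _
  | comp_assoc f g h => exact P.comp_assoc _ _ _
  | tensor_id m n => exact P.tensor_id _ _
  | tensor_comp f g f' g' => exact P.tensor_comp _ _ _ _
  | tensor_assoc f g h => exact (P.eval_castHom δ _ _ _).trans (P.tensor_assoc _ _ _)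
  | zero_tensor f => exact (P.eval_castHom δ _ _ _).trans (P.zero_tensor _)
  | tensor_zero f => exact (P.eval_castHom δ _ _ _).trans (P.tensor_zero _)
  | symm_natural f g => exact P.symm_natural _ _
  | symm_symm m n => exact P.symm_symm _ _
  | symm_hexagon m n p =>
    rw [eval_castHom, eval, eval, eval_castHom]
    exact P.symm_hexagon m n p
  | coassoc => exact hδ.coassoc
  | cocomm => exact hδ.cocomm

theorem IsCocom.isNormal_eval (hδ : IsCocom δ) {m n : ℕ} (t : Term m n) :
    IsNormal δ (P.eval δ t) := by
  induction t with
  | id n => exact .id n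
  | comp f g ih ih' => exact ih.comp hδ ih'
  | tensor f g ih ih' => exact ih.tensor hδ ih'
  | symm m n => exact .symm hδ m n
  | delta => exact .delta

end PROP

namespace Cocom

/-- The universal property of `Cocom`: the interpretation of formal composites in a PROP with a
cocommutative coassociative `δ` respects the relations of `Cocom`. -/
def lift {P : PROP.{u}} {δ : P.Hom 1 2} (hδ : IsCocom δ) : PROPHom Cocom P where
  map f := Quotient.lift (P.eval δ) (fun _ _ h => hδ.eval_eq_of_rel h) f
  map_id _ := rfl
  map_comp f g := by
    induction f using Quotient.ind
    induction g using Quotient.ind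
    rfl
  map_tensor f g := by
    induction f using Quotient.ind
    induction g using Quotient.ind
    rfl
  map_symm _ _ := rfl

theorem isCocom_delta : IsCocom Cocom.delta where
  coassoc := Quotient.sound CocomRel.coassoc
  cocomm := Quotient.sound CocomRel.cocomm

theorem eval_delta {m n : ℕ} (t : Term m n) :
    Cocom.eval Cocom.delta t = Quotient.mk (cocomSetoid m n) t := by
  induction t with
  | comp f g ih ih' => exact congrArg₂ Cocom.comp ih ih'
  | tensor f g ih ih' => exact congrArg₂ Cocom.tensor ih ih'
  | _ => rfl

theorem isNormal {m n : ℕ} (f : Cocom.Hom m n) : IsNormal Cocom.delta f := by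
  induction f using Quotient.ind with
  | _ t => exact eval_delta t ▸ isCocom_delta.isNormal_eval t

end Cocom

namespace SurjOp

theorem isCocom_delta : IsCocom SurjOp.delta where
  coassoc := Subtype.ext (funext fun _ => Subsingleton.elim (α := Fin 1) _ _)
  cocomm := Subtype.ext (funext fun _ => Subsingleton.elim (α := Fin 1) _ _)

theorem comp_apply {m n p : ℕ} (f : SurjOp.Hom m n) (g : SurjOp.Hom n p) (j : Fin p) :
    (f ≫ g).1 j = f.1 (g.1 j) := rfl

theorem whisker_last {m n : ℕ} (f : SurjOp.Hom m n) :
    (SurjOp.whisker f).1 (Fin.last n) = Fin.last m := finSumMap_natAdd f.1 id 0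

theorem whisker_castSucc {m n : ℕ} (f : SurjOp.Hom m n) (j : Fin n) :
    (SurjOp.whisker f).1 j.castSucc = (f.1 j).castSucc := finSumMap_castAdd f.1 id j

theorem swapLast_last (n : ℕ) :
    (SurjOp.swapLast n).1 (Fin.last (n + 1)) = (Fin.last n).castSucc :=
  finSumMap_natAdd (n := n) (m' := 2) (n' := 2) id (SurjOp.symm 1 1).1 1

theorem swapLast_castSucc_last (n : ℕ) :
    (SurjOp.swapLast n).1 (Fin.last n).castSucc = Fin.last (n + 1) :=
  finSumMap_natAdd (n := n) (m' := 2) (n' := 2) id (SurjOp.symm 1 1).1 0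

theorem swapLast_castSucc_castSucc (n : ℕ) (j : Fin n) :
    (SurjOp.swapLast n).1 j.castSucc.castSucc = j.castSucc.castSucc :=
  finSumMap_castAdd (n := n) (m' := 2) (n' := 2) id (SurjOp.symm 1 1).1 j

theorem atLast_delta_last (n : ℕ) : (atLast SurjOp.delta n).1 (Fin.last (n + 1)) = Fin.last n :=
  finSumMap_natAdd (n := n) (n' := 2) id SurjOp.delta.1 1

theorem atLast_delta_castSucc (n : ℕ) (j : Fin (n + 1)) :
    (atLast SurjOp.delta n).1 j.castSucc = j := by
  induction j using Fin.lastCases with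
  | last => exact finSumMap_natAdd (n := n) (n' := 2) id SurjOp.delta.1 0
  | cast j => exact finSumMap_castAdd (n := n) (n' := 2) id SurjOp.delta.1 j

end SurjOp

namespace Extraction

open SurjOp

theorem surjOp_eval_succ_last {a b : ℕ} (x : Extraction a b) :
    (x.succ.eval SurjOp.delta).1 (Fin.last (b + 1)) =
      ((x.eval SurjOp.delta).1 (Fin.last b)).castSucc := by
  rw [eval, comp_apply, swapLast_last, whisker_castSucc]

theorem surjOp_eval_succ_castSucc_last {a b : ℕ} (x : Extraction a b) :
    (x.succ.eval SurjOp.delta).1 (Fin.last b).castSucc = Fin.last a := by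
  rw [eval, comp_apply, swapLast_castSucc_last, whisker_last]

theorem surjOp_eval_succ_castSucc_castSucc {a b : ℕ} (x : Extraction a b) (j : Fin b) :
    (x.succ.eval SurjOp.delta).1 j.castSucc.castSucc =
      ((x.eval SurjOp.delta).1 j.castSucc).castSucc := by
  rw [eval, comp_apply, swapLast_castSucc_castSucc, whisker_castSucc]

theorem surjOp_eval_comp_castSucc_injective {a b : ℕ} (x : Extraction a b) :
    Function.Injective fun j : Fin b => (x.eval SurjOp.delta).1 j.castSucc := by
  induction x with
  | move b => exact Fin.castSucc_injective b
  | split b =>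
    intro i j h
    simpa only [eval, atLast_delta_castSucc] using h
  | succ x ih =>
    intro i j h
    induction i using Fin.lastCases <;> induction j using Fin.lastCases
    · rfl
    · simp only [surjOp_eval_succ_castSucc_last, surjOp_eval_succ_castSucc_castSucc] at h
      exact absurd h.symm (Fin.castSucc_ne_last _)
    · simp only [surjOp_eval_succ_castSucc_last, surjOp_eval_succ_castSucc_castSucc] at h
      exact absurd h (Fin.castSucc_ne_last _)
    · simp only [surjOp_eval_succ_castSucc_castSucc] at h
      exact congrArg Fin.castSucc (ih (Fin.castSucc_injective _ h))

theorem eq_of_surjOp_eval_last_eq {a b : ℕ} {x y : Extraction a b}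
    (h : (x.eval SurjOp.delta).1 (Fin.last b) = (y.eval SurjOp.delta).1 (Fin.last b)) :
    x = y := by
  induction x with
  | move b =>
    cases y with
    | move => rfl
    | succ y =>
      rw [surjOp_eval_succ_last] at h
      exact absurd h.symm (Fin.castSucc_ne_last _)
  | split b =>
    cases y with
    | split => rfl
    | succ y =>
      rw [surjOp_eval_succ_last, eval, atLast_delta_last] at h
      exact absurd h.symm (Fin.castSucc_ne_last _)
  | succ x ih =>
    cases y with
    | move =>
      rw [surjOp_eval_succ_last] at h
      exact absurd h (Fin.castSucc_ne_last _)
    | split =>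
      rw [surjOp_eval_succ_last, eval, atLast_delta_last] at h
      exact absurd h (Fin.castSucc_ne_last _)
    | succ y =>
      rw [surjOp_eval_succ_last, surjOp_eval_succ_last] at h
      rw [ih (Fin.castSucc_injective _ h)]

theorem exists_surjOp_eval_eq_id {a : ℕ} (i : Fin a) : ∃ x : Extraction a a,
    (x.eval SurjOp.delta).1 (Fin.last a) = i ∧
      ∀ j : Fin a, (x.eval SurjOp.delta).1 j.castSucc = j := by
  induction a with
  | zero => exact i.elim0
  | succ a ih =>
    induction i using Fin.lastCases with
    | last => exact ⟨split a, atLast_delta_last a, atLast_delta_castSucc a⟩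
    | cast i =>
      obtain ⟨x, hx, hx'⟩ := ih i
      refine ⟨succ x, by rw [surjOp_eval_succ_last, hx], Fin.lastCases ?_ fun j => ?_⟩
      · exact surjOp_eval_succ_castSucc_last x
      · rw [surjOp_eval_succ_castSucc_castSucc, hx']

theorem exists_surjOp_eval_eq_succAbove {a : ℕ} (i : Fin (a + 1)) : ∃ x : Extraction (a + 1) a,
    (x.eval SurjOp.delta).1 (Fin.last a) = i ∧
      ∀ j : Fin a, (x.eval SurjOp.delta).1 j.castSucc = i.succAbove j := by
  induction a with
  | zero => exact ⟨move 0, Subsingleton.elim (α := Fin 1) _ _, fun j => j.elim0⟩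
  | succ a ih =>
    cases i using Fin.lastCases with
    | last => exact ⟨move (a + 1), rfl, fun j => (Fin.succAbove_last_apply j).symm⟩
    | cast i =>
      obtain ⟨x, hx, hx'⟩ := ih i
      refine ⟨succ x, by rw [surjOp_eval_succ_last, hx], Fin.lastCases ?_ fun j => ?_⟩
      · rw [surjOp_eval_succ_castSucc_last, Fin.succAbove_ne_last_last (Fin.castSucc_ne_last i)]
      · rw [surjOp_eval_succ_castSucc_castSucc, hx', Fin.castSucc_succAbove_castSucc]

theorem exists_surjOp_eval_of_surjective {m n : ℕ} {φ : Fin (n + 1) → Fin m}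
    (hφ : Function.Surjective φ) :
    ∃ (b : ℕ) (x : Extraction m b) (ψ : Fin n → Fin b), Function.Surjective ψ ∧
      (x.eval SurjOp.delta).1 (Fin.last b) = φ (Fin.last n) ∧
        ∀ j, (x.eval SurjOp.delta).1 (ψ j).castSucc = φ j.castSucc := by
  by_cases hn : ∃ j : Fin n, φ j.castSucc = φ (Fin.last n)
  · obtain ⟨x, hx, hx'⟩ := exists_surjOp_eval_eq_id (φ (Fin.last n))
    refine ⟨m, x, φ ∘ Fin.castSucc, fun i => ?_, hx, fun j => hx' _⟩
    obtain ⟨j, rfl⟩ := hφ i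
    cases j using Fin.lastCases with
    | last => exact hn
    | cast j => exact ⟨j, rfl⟩
  · cases m with
    | zero => exact (φ (Fin.last n)).elim0
    | succ b =>
      obtain ⟨x, hx, hx'⟩ := exists_surjOp_eval_eq_succAbove (φ (Fin.last n))
      choose ψ hψ using fun j : Fin n => Fin.exists_succAbove_eq (not_exists.1 hn j)
      refine ⟨b, x, ψ, fun i => ?_, hx, fun j => (hx' _).trans (hψ j)⟩
      obtain ⟨j, hj⟩ := hφ ((φ (Fin.last n)).succAbove i)
      cases j using Fin.lastCases with
      | last => exact absurd hj.symm (Fin.succAbove_ne _ i)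
      | cast j => exact ⟨j, Fin.succAbove_right_injective ((hψ j).trans hj)⟩

end Extraction

namespace NormalForm

open SurjOp

theorem surjOp_eval_cons_last {a b n : ℕ} (x : Extraction a b) (N : NormalForm b n) :
    ((cons x N).eval SurjOp.delta).1 (Fin.last n) = (x.eval SurjOp.delta).1 (Fin.last b) := by
  rw [eval, comp_apply, whisker_last]

theorem surjOp_eval_cons_castSucc {a b n : ℕ} (x : Extraction a b) (N : NormalForm b n)
    (j : Fin n) : ((cons x N).eval SurjOp.delta).1 j.castSucc =
      (x.eval SurjOp.delta).1 ((N.eval SurjOp.delta).1 j).castSucc := by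
  rw [eval, comp_apply, whisker_castSucc]

theorem card_image_surjOp_eval_cons {a b n : ℕ} (x : Extraction a b) (N : NormalForm b n) :
    (Finset.univ.image fun j : Fin n =>
      ((cons x N).eval SurjOp.delta).1 j.castSucc).card = b := by
  have h : (fun j : Fin n => ((cons x N).eval SurjOp.delta).1 j.castSucc) =
      (fun k : Fin b => (x.eval SurjOp.delta).1 k.castSucc) ∘ (N.eval SurjOp.delta).1 :=
    funext (surjOp_eval_cons_castSucc x N)
  rw [h, ← Finset.image_image, Finset.image_univ_of_surjective (N.eval SurjOp.delta).2,
    Finset.card_image_of_injective _ x.surjOp_eval_comp_castSucc_injective, Finset.card_fin]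

theorem surjOp_eval_injective {m n : ℕ} :
    Function.Injective fun N : NormalForm m n => N.eval SurjOp.delta := by
  intro M N h
  induction M with
  | nil => cases N; rfl
  | @cons m b n x M ih =>
    cases N with
    | @cons _ b' _ y N =>
      have hφ (j : Fin (n + 1)) : ((cons x M).eval SurjOp.delta).1 j =
          ((cons y N).eval SurjOp.delta).1 j := congrArg (fun f : SurjOp.Hom _ _ => f.1 j) h
      obtain rfl : b = b' := by
        rw [← card_image_surjOp_eval_cons x M, ← card_image_surjOp_eval_cons y N]
        simp only [hφ]
      obtain rfl : x = y := Extraction.eq_of_surjOp_eval_last_eq <| by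
        rw [← surjOp_eval_cons_last x M, ← surjOp_eval_cons_last y N, hφ]
      have hMN : M.eval SurjOp.delta = N.eval SurjOp.delta := by
        refine Subtype.ext (funext fun j => x.surjOp_eval_comp_castSucc_injective ?_)
        simpa only [surjOp_eval_cons_castSucc] using hφ j.castSucc
      rw [ih hMN]

theorem surjOp_eval_surjective {m n : ℕ} :
    Function.Surjective fun N : NormalForm m n => N.eval SurjOp.delta := by
  rintro ⟨φ, hφ⟩
  induction n generalizing m with
  | zero =>
    cases m with
    | zero => exact ⟨nil, Subtype.ext (funext fun j => j.elim0)⟩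
    | succ m => exact (hφ 0).choose.elim0
  | succ n ih =>
    obtain ⟨b, x, ψ, hψ, hlast, hcast⟩ := Extraction.exists_surjOp_eval_of_surjective hφ
    obtain ⟨N, hN⟩ := ih ψ hψ
    refine ⟨cons x N, Subtype.ext (funext (Fin.lastCases ?_ fun j => ?_))⟩
    · exact (surjOp_eval_cons_last x N).trans hlast
    · exact (surjOp_eval_cons_castSucc x N j).trans
        ((congrArg (fun f : SurjOp.Hom b n => (x.eval SurjOp.delta).1 (f.1 j).castSucc) hN).trans
          (hcast j))

end NormalForm

namespace Cocom

/-- The comparison of `Cocom` with surjections. -/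
def toSurjOp : PROPHom Cocom SurjOp := lift SurjOp.isCocom_delta

theorem toSurjOp_delta : toSurjOp.map Cocom.delta = SurjOp.delta := rfl

theorem toSurjOp_injective {m n : ℕ} :
    Function.Injective (toSurjOp.map : Cocom.Hom m n → SurjOp.Hom m n) := by
  intro f g h
  obtain ⟨M, rfl⟩ := isNormal f
  obtain ⟨N, rfl⟩ := isNormal g
  rw [PROPHom.map_normalForm_eval, PROPHom.map_normalForm_eval] at h
  rw [NormalForm.surjOp_eval_injective h]

theorem toSurjOp_surjective {m n : ℕ} :
    Function.Surjective (toSurjOp.map : Cocom.Hom m n → SurjOp.Hom m n) := by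
  intro φ
  obtain ⟨N, rfl⟩ := NormalForm.surjOp_eval_surjective φ
  exact ⟨N.eval Cocom.delta, PROPHom.map_normalForm_eval _ _ _⟩

end Cocom

/-! ### Isomorphisms of PROPs -/

namespace PROPHom

variable {P : PROP.{u}} {Q : PROP.{v}} {R : PROP.{w}}

/-- Composition of morphisms of PROPs. -/
def comp (G : PROPHom Q R) (F : PROPHom P Q) : PROPHom P R where
  map f := G.map (F.map f)
  map_id n := by rw [F.map_id, G.map_id]
  map_comp f g := by rw [F.map_comp, G.map_comp]
  map_tensor f g := by rw [F.map_tensor, G.map_tensor]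
  map_symm m n := by rw [F.map_symm, G.map_symm]

/-- The image of a morphism of PROPs, as a sub-PROP of the target. -/
def range (F : PROPHom P Q) : SubPROP Q where
  carrier _ _ := Set.range F.map
  id_mem n := ⟨P.id n, F.map_id n⟩
  comp_mem := by
    rintro m n p _ _ ⟨f, rfl⟩ ⟨g, rfl⟩
    exact ⟨P.comp f g, F.map_comp f g⟩
  tensor_mem := by
    rintro m n m' n' _ _ ⟨f, rfl⟩ ⟨g, rfl⟩
    exact ⟨P.tensor f g, F.map_tensor f g⟩
  symm_mem m n := ⟨P.symm m n, F.map_symm m n⟩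

/-- Restriction of the codomain of a morphism of PROPs. -/
def codRestrict (F : PROPHom P Q) (S : SubPROP Q)
    (h : ∀ {m n : ℕ} (f : P.Hom m n), F.map f ∈ S.carrier m n) : PROPHom P S.toPROP where
  map f := ⟨F.map f, h f⟩
  map_id n := Subtype.ext (F.map_id n)
  map_comp f g := Subtype.ext (F.map_comp f g)
  map_tensor f g := Subtype.ext (F.map_tensor f g)
  map_symm m n := Subtype.ext (F.map_symm m n)

end PROPHom

namespace PROPIso

variable {P : PROP.{u}} {Q : PROP.{v}} {R : PROP.{w}}

/-- The inverse of an isomorphism of PROPs. -/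
def symm (F : PROPIso P Q) : PROPIso Q P where
  hom := F.inv
  inv := F.hom
  inv_hom := F.hom_inv
  hom_inv := F.inv_hom

/-- Composition of isomorphisms of PROPs, in diagrammatic order. -/
def trans (F : PROPIso P Q) (G : PROPIso Q R) : PROPIso P R where
  hom := G.hom.comp F.hom
  inv := F.inv.comp G.inv
  inv_hom f := (congrArg F.inv.map (G.inv_hom _)).trans (F.inv_hom f)
  hom_inv g := (congrArg G.hom.map (F.hom_inv _)).trans (G.hom_inv g)

/-- A bijective morphism of PROPs, as an isomorphism. -/
noncomputable def ofBijective (F : PROPHom P Q)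
    (hF : ∀ m n : ℕ, Function.Bijective (F.map : P.Hom m n → Q.Hom m n)) : PROPIso P Q :=
  have map_surjInv {m n : ℕ} (g : Q.Hom m n) : F.map (Function.surjInv (hF m n).2 g) = g :=
    Function.surjInv_eq _ g
  { hom := F
    inv :=
      { map := Function.surjInv (hF _ _).2
        map_id := fun n => (hF n n).1 <| by rw [map_surjInv, F.map_id]
        map_comp := fun f g => (hF _ _).1 <| by simp only [F.map_comp, map_surjInv]
        map_tensor := fun f g => (hF _ _).1 <| by simp only [F.map_tensor, map_surjInv]
        map_symm := fun m n => (hF _ _).1 <| by rw [map_surjInv, F.map_symm] }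
    inv_hom := fun _ => (hF _ _).1 (map_surjInv _)
    hom_inv := map_surjInv }

/-- An injective morphism of PROPs, as an isomorphism onto its image. The image is given as a
sub-PROP which agrees with it, since several morphisms may have to share it. -/
noncomputable def ofInjective (F : PROPHom P Q)
    (hF : ∀ m n : ℕ, Function.Injective (F.map : P.Hom m n → Q.Hom m n)) (S : SubPROP Q)
    (hS : ∀ m n : ℕ, Set.range (F.map : P.Hom m n → Q.Hom m n) = S.carrier m n) :
    PROPIso P S.toPROP :=
  ofBijective (F.codRestrict S fun f => (hS _ _).subset ⟨f, rfl⟩) fun m n =>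
    ⟨fun _ _ h => hF m n (congrArg Subtype.val h), fun g =>
      ((hS m n).superset g.2).imp fun _ hf => Subtype.ext hf⟩

end PROPIso

namespace kerQuot

variable {P : PROP.{u}} {Q : PROP.{v}} (F : PROPHom P Q)

/-- The morphism induced on the quotient by the kernel congruence. -/
def lift : PROPHom (kerQuot F) Q where
  map f := Quotient.lift F.map (fun _ _ h => h) f
  map_id n := F.map_id n
  map_comp f g := by
    induction f using Quotient.ind
    induction g using Quotient.ind
    exact F.map_comp _ _
  map_tensor f g := by
    induction f using Quotient.ind
    induction g using Quotient.ind
    exact F.map_tensor _ _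
  map_symm m n := F.map_symm m n

theorem lift_injective (m n : ℕ) :
    Function.Injective ((lift F).map : (kerQuot F).Hom m n → Q.Hom m n) :=
  Setoid.kerLift_injective F.map

/-- The first isomorphism theorem for PROPs. -/
noncomputable def isoRange : PROPIso (kerQuot F) F.range.toPROP :=
  PROPIso.ofInjective (lift F) (lift_injective F) F.range fun _ _ => Set.range_quot_lift _

end kerQuot

theorem finAddFlip_symm (m n : ℕ) :
    (finAddFlip : Fin (m + n) ≃ Fin (n + m)).symm = finAddFlip := by
  ext1 j
  rw [Equiv.symm_apply_eq]
  induction j using Fin.addCases <;> simp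

/-! ### Surjections as corelations -/

namespace SurjOp

variable {m n p : ℕ}

/-- The corelation in which every output is equivalent to the input to which `φ` sends it, so that
its classes are the fibres of `φ`, each with one input added. -/
@[reducible] def corel (φ : Fin n → Fin m) : Corel m n := Setoid.ker (Sum.elim id φ)

theorem sat_corel_iff {φ : Fin n → Fin m} {Z : Type} {a : Fin m → Z} {b : Fin n → Z} :
    Corel.Sat (corel φ) a b ↔ b = a ∘ φ := by
  refine ⟨fun h => funext fun j => h (inr j) (inl (φ j)) rfl, ?_⟩
  rintro rfl x y hxy
  have factors : Sum.elim a (a ∘ φ) = a ∘ Sum.elim id φ := (Sum.comp_elim a id φ).symm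
  rw [factors]
  exact congrArg a hxy

theorem corel_comp (φ : Fin n → Fin m) (ψ : Fin p → Fin n) :
    corel (φ ∘ ψ) = Corel.comp (corel φ) (corel ψ) :=
  Corel.ext_sat fun Z a c => by
    rw [sat_corel_iff]
    constructor
    · rintro rfl
      exact Corel.sat_comp (b := a ∘ φ) (sat_corel_iff.2 rfl) (sat_corel_iff.2 rfl)
    · intro h
      obtain ⟨b, hb, hc⟩ := Corel.exists_of_sat_comp h
      rw [sat_corel_iff] at hb hc
      subst hb
      exact (Option.some_injective Z).comp_left hc

theorem corel_injective : Function.Injective (corel : (Fin n → Fin m) → Corel m n) := by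
  intro φ ψ h
  have sat : Corel.Sat (corel ψ) (_root_.id : Fin m → Fin m) φ := h ▸ sat_corel_iff.2 rfl
  exact sat_corel_iff (φ := ψ).1 sat

theorem corel_tensor {m' n' : ℕ} (φ : Fin n → Fin m) (ψ : Fin n' → Fin m') :
    corel (finSumMap φ ψ) = Corel.tensor (corel φ) (corel ψ) :=
  Corel.ext_sat fun Z a b => by
    simp only [Corel.sat_tensor, sat_corel_iff, funext_iff, Fin.forall_fin_add,
      Function.comp_apply, finSumMap_castAdd, finSumMap_natAdd]

theorem corel_equiv_symm (e : Fin m ≃ Fin n) : corel e.symm = Corel.ofEquiv e :=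
  Corel.ext_sat fun Z a b => by
    rw [Corel.sat_ofEquiv, sat_corel_iff, Equiv.eq_comp_symm]
    exact ⟨fun h i => (congrFun h i).symm, fun h => funext fun i => (h i).symm⟩

/-- Surjections as corelations, functorially. -/
def toFinCorel : PROPHom SurjOp FinCorel where
  map φ := corel φ.1
  map_id n := corel_equiv_symm (Equiv.refl (Fin n))
  map_comp f g := corel_comp f.1 g.1
  map_tensor f g := corel_tensor f.1 g.1
  map_symm m n := (congrArg (fun e : Fin (n + m) ≃ Fin (m + n) => corel e)
    (finAddFlip_symm m n)).symm.trans (corel_equiv_symm finAddFlip)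

theorem toFinCorel_injective (m n : ℕ) :
    Function.Injective (toFinCorel.map : SurjOp.Hom m n → FinCorel.Hom m n) :=
  fun _ _ h => Subtype.ext (corel_injective h)

theorem isCirc_corel {φ : Fin n → Fin m} (hφ : Function.Surjective φ) : (corel φ).IsCirc := by
  constructor
  · rintro _ ⟨y, rfl⟩
    exact ⟨Sum.elim id φ y, rfl, fun i hi => hi⟩
  · rintro _ ⟨y, rfl⟩
    exact hφ (Sum.elim id φ y)

theorem exists_surjective_corel_eq {R : Corel m n} (hR : R.IsCirc) :
    ∃ φ : Fin n → Fin m, Function.Surjective φ ∧ corel φ = R := by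
  have existsUnique_input (x) : ∃! i : Fin m, R (inl i) x := hR.1 {y | R y x} (R.mem_classes x)
  have exists_output (x) : ∃ j : Fin n, R (inr j) x := hR.2 {y | R y x} (R.mem_classes x)
  choose φ hφ using fun j => (existsUnique_input (inr j)).exists
  have rel_elim : ∀ x, R (inl (Sum.elim id φ x)) x := by
    rintro (i | j)
    · exact R.refl _
    · exact hφ j
  refine ⟨φ, fun i => ?_, Setoid.ext fun x y => ⟨fun h => ?_, fun h => ?_⟩⟩
  · obtain ⟨j, hj⟩ := exists_output (inl i)
    exact ⟨j, (existsUnique_input (inl i)).unique (R.trans (hφ j) hj) (R.refl _)⟩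
  · have same_input : Sum.elim id φ x = Sum.elim id φ y := h
    exact R.trans (R.symm (rel_elim x)) (same_input ▸ rel_elim y)
  · exact (existsUnique_input y).unique (R.trans (rel_elim x) h) (rel_elim y)

theorem range_toFinCorel (m n : ℕ) :
    Set.range (toFinCorel.map : SurjOp.Hom m n → FinCorel.Hom m n) =
      {R : Corel m n | R.IsCirc} := by
  ext R
  constructor
  · rintro ⟨φ, rfl⟩
    exact isCirc_corel φ.2
  · intro hR
    obtain ⟨φ, hφ, rfl⟩ := exists_surjective_corel_eq hR
    exact ⟨⟨φ, hφ⟩, rfl⟩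

end SurjOp

/-! ### Roots in a diagram -/

namespace Diagram

variable {m n : ℕ}

/-- `r` and `φ` label the vertices and the outputs by inputs in such a way that every wire ends
with the label it starts with: they send a vertex, or an output, to the input from which it
descends. -/
def IsRoot (G : Diagram m n) (r : G.V → Fin m) (φ : Fin n → Fin m) : Prop :=
  ∀ s, Sum.elim φ r (G.wire s) = Sum.elim id (fun x => r x.1) s

/-- There is a wire from the vertex `a` to the vertex `b`. -/
def Parent (G : Diagram m n) (a b : G.V) : Prop := ∃ s, G.wire (inr (a, s)) = inr b

theorem wellFounded_parent (G : Diagram m n) : WellFounded G.Parent := by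
  have := G.finite
  have : Std.Irrefl (Relation.TransGen G.Parent) := ⟨G.acyclic⟩
  exact (Finite.wellFounded_of_trans_of_irrefl (Relation.TransGen G.Parent)).mono
    fun _ _ => .single

theorem wellFounded_child (G : Diagram m n) : WellFounded (Function.swap G.Parent) := by
  have := G.finite
  have : Std.Irrefl (Relation.TransGen G.Parent) := ⟨G.acyclic⟩
  exact (Finite.wellFounded_of_trans_of_irrefl (Function.swap (Relation.TransGen G.Parent))).mono
    fun _ _ h => .single h

theorem exists_vertex_label (G : Diagram m n) : ∃ r : G.V → Fin m,
    ∀ v, r v = Sum.elim id (fun x => r x.1) (G.wire.symm (inr v)) := by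
  let step (v : G.V) (ih : ∀ u, G.Parent u v → Fin m) : Fin m :=
    match h : G.wire.symm (inr v) with
    | inl i => i
    | inr (u, s) => ih u ⟨s, by rw [← h, Equiv.apply_symm_apply]⟩
  refine ⟨G.wellFounded_parent.fix step, fun v => ?_⟩
  rw [G.wellFounded_parent.fix_eq]
  simp only [step]
  split <;> rename_i h <;> rw [h] <;> rfl

theorem exists_isRoot (G : Diagram m n) : ∃ r φ, G.IsRoot r φ := by
  obtain ⟨r, hr⟩ := G.exists_vertex_label
  refine ⟨r, fun j => Sum.elim id (fun x => r x.1) (G.wire.symm (inl j)), fun s => ?_⟩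
  obtain ⟨t, rfl⟩ := G.wire.symm.surjective s
  rw [Equiv.apply_symm_apply]
  cases t with
  | inl j => rfl
  | inr v => exact hr v

theorem reachable_wire (G : Diagram m n) (s : Fin m ⊕ G.V × Bool) :
    G.underlying.Reachable (G.srcNode s) (G.tgtNode (G.wire s)) := by
  by_cases h : G.srcNode s = G.tgtNode (G.wire s)
  · rw [h]
  · exact SimpleGraph.Adj.reachable ((SimpleGraph.fromRel_adj _ _ _).2 ⟨h, .inl ⟨s, rfl, rfl⟩⟩)

namespace IsRoot

variable {G : Diagram m n} {r : G.V → Fin m} {φ : Fin n → Fin m}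

theorem surjective (h : G.IsRoot r φ) : Function.Surjective φ := by
  have mem_range_of_vertex (t) (ht : ∀ v, t = inr v → r v ∈ Set.range φ) :
      Sum.elim φ r t ∈ Set.range φ := by
    cases t with
    | inl j => exact ⟨j, rfl⟩
    | inr v => exact ht v rfl
  have vertex (v : G.V) : r v ∈ Set.range φ := by
    induction v using G.wellFounded_child.induction with
    | _ v ih =>
      have label : Sum.elim φ r (G.wire (inr (v, false))) = r v := h _
      exact label ▸ mem_range_of_vertex _ fun w hw => ih w ⟨false, hw⟩
  intro i
  have label : Sum.elim φ r (G.wire (inl i)) = i := h _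
  exact label ▸ mem_range_of_vertex _ fun v _ => vertex v

theorem label_eq_of_reachable (h : G.IsRoot r φ) {x y : (Fin m ⊕ Fin n) ⊕ G.V}
    (hxy : G.underlying.Reachable x y) :
    Sum.elim (Sum.elim id φ) r x = Sum.elim (Sum.elim id φ) r y := by
  have wire (s) : Sum.elim (Sum.elim id φ) r (G.srcNode s) =
      Sum.elim (Sum.elim id φ) r (G.tgtNode (G.wire s)) := by
    have hs := h s
    rcases s with i | ⟨v, s⟩ <;> rcases hw : G.wire _ with j | w <;> rw [hw] at hs <;>
      exact hs.symm
  obtain ⟨p⟩ := hxy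
  induction p with
  | nil => rfl
  | cons hadj _ ih =>
    obtain ⟨-, ⟨s, rfl, rfl⟩ | ⟨s, rfl, rfl⟩⟩ := (SimpleGraph.fromRel_adj _ _ _).1 hadj
    · exact (wire s).trans ih
    · exact (wire s).symm.trans ih

theorem reachable_tgtNode (h : G.IsRoot r φ) (t : Fin n ⊕ G.V)
    (ht : ∀ u s, G.wire (inr (u, s)) = t → G.underlying.Reachable (inl (inl (r u))) (inr u)) :
    G.underlying.Reachable (inl (inl (Sum.elim φ r t))) (G.tgtNode t) := by
  obtain ⟨s, rfl⟩ := G.wire.surjective t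
  rw [h s]
  refine SimpleGraph.Reachable.trans ?_ (G.reachable_wire s)
  rcases s with i | ⟨u, s⟩
  · exact .refl _
  · exact ht u s rfl

theorem reachable_vertex (h : G.IsRoot r φ) (v : G.V) :
    G.underlying.Reachable (inl (inl (r v))) (inr v) := by
  induction v using G.wellFounded_parent.induction with
  | _ v ih => exact h.reachable_tgtNode (inr v) fun u s hs => ih u ⟨s, hs⟩

theorem reachable_boundary (h : G.IsRoot r φ) (x : Fin m ⊕ Fin n) :
    G.underlying.Reachable (inl (inl (Sum.elim id φ x))) (inl x) := by
  cases x with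
  | inl i => exact .refl _
  | inr j => exact h.reachable_tgtNode (inl j) fun u _ _ => h.reachable_vertex u

theorem ancestry_eq (h : G.IsRoot r φ) : G.ancestry = SurjOp.corel φ := by
  ext x y
  constructor
  · exact fun hxy => h.label_eq_of_reachable hxy
  · intro hxy
    have same_root : Sum.elim id φ x = Sum.elim id φ y := hxy
    exact (h.reachable_boundary x).symm.trans (same_root ▸ h.reachable_boundary y)

theorem ofEquiv (e : Fin m ≃ Fin n) : (Diagram.ofEquiv e).IsRoot (fun v => v.elim) e.symm := by
  rintro (i | ⟨v, -⟩)
  · exact e.symm_apply_apply i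
  · exact v.elim

theorem comp {p : ℕ} {H : Diagram n p} {r' : H.V → Fin n} {ψ : Fin p → Fin n}
    (h : G.IsRoot r φ) (h' : H.IsRoot r' ψ) :
    (G.comp H).IsRoot (Sum.elim r (φ ∘ r')) (φ ∘ ψ) := by
  have second (t) : Sum.elim (φ ∘ ψ) (Sum.elim r (φ ∘ r')) (Sum.map id inr t) =
      φ (Sum.elim ψ r' t) := by
    cases t <;> rfl
  have first (t) : Sum.elim (φ ∘ ψ) (Sum.elim r (φ ∘ r')) (Wiring.bridge G.V H.wire t) =
      Sum.elim φ r t := by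
    cases t with
    | inl j => exact (second _).trans (congrArg φ (h' (inl j)))
    | inr v => rfl
  rintro (i | ⟨v | w, s⟩)
  · exact (congrArg _ (Wiring.comp_inl G.wire H.wire i)).trans ((first _).trans (h _))
  · exact (congrArg _ (Wiring.comp_inr_inl G.wire H.wire v s)).trans ((first _).trans (h _))
  · exact (congrArg _ (Wiring.comp_inr_inr G.wire H.wire w s)).trans
      ((second _).trans (congrArg φ (h' _)))

theorem tensor {m' n' : ℕ} {H : Diagram m' n'} {r' : H.V → Fin m'} {ψ : Fin n' → Fin m'}
    (h : G.IsRoot r φ) (h' : H.IsRoot r' ψ) :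
    (G.tensor H).IsRoot (Sum.elim (Fin.castAdd m' ∘ r) (Fin.natAdd m ∘ r'))
      (finSumMap φ ψ) := by
  have first (t) : Sum.elim (finSumMap φ ψ) (Sum.elim (Fin.castAdd m' ∘ r) (Fin.natAdd m ∘ r'))
      (Sum.map (Fin.castAdd n') inl t) = Fin.castAdd m' (Sum.elim φ r t) := by
    cases t with
    | inl j => exact finSumMap_castAdd φ ψ j
    | inr v => rfl
  have second (t) : Sum.elim (finSumMap φ ψ) (Sum.elim (Fin.castAdd m' ∘ r) (Fin.natAdd m ∘ r'))
      (Sum.map (Fin.natAdd n) inr t) = Fin.natAdd m (Sum.elim ψ r' t) := by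
    cases t with
    | inl j => exact finSumMap_natAdd φ ψ j
    | inr w => rfl
  rintro (i | ⟨v | w, s⟩)
  · cases i using Fin.addCases with
    | left i =>
      exact (congrArg _ (Wiring.tensor_castAdd G.wire H.wire i)).trans
        ((first _).trans ((congrArg _ (h _)).trans (by simp)))
    | right i =>
      exact (congrArg _ (Wiring.tensor_natAdd G.wire H.wire i)).trans
        ((second _).trans (congrArg _ (h' _)))
  · exact (congrArg _ (Wiring.tensor_inr_inl G.wire H.wire v s)).trans
      ((first _).trans (congrArg _ (h _)))
  · exact (congrArg _ (Wiring.tensor_inr_inr G.wire H.wire w s)).trans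
      ((second _).trans (congrArg _ (h' _)))

end IsRoot

theorem ancestry_ofEquiv (e : Fin m ≃ Fin n) : (ofEquiv e).ancestry = Corel.ofEquiv e :=
  (IsRoot.ofEquiv e).ancestry_eq.trans (SurjOp.corel_equiv_symm e)

theorem ancestry_comp {p : ℕ} (G : Diagram m n) (H : Diagram n p) :
    (G.comp H).ancestry = Corel.comp G.ancestry H.ancestry := by
  obtain ⟨r, φ, hG⟩ := G.exists_isRoot
  obtain ⟨r', ψ, hH⟩ := H.exists_isRoot
  rw [(hG.comp hH).ancestry_eq, SurjOp.corel_comp, hG.ancestry_eq, hH.ancestry_eq]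

theorem ancestry_tensor {m' n' : ℕ} (G : Diagram m n) (H : Diagram m' n') :
    (G.tensor H).ancestry = Corel.tensor G.ancestry H.ancestry := by
  obtain ⟨r, φ, hG⟩ := G.exists_isRoot
  obtain ⟨r', ψ, hH⟩ := H.exists_isRoot
  rw [(hG.tensor hH).ancestry_eq, SurjOp.corel_tensor, hG.ancestry_eq, hH.ancestry_eq]

theorem isCirc_ancestry (G : Diagram m n) : G.ancestry.IsCirc := by
  obtain ⟨r, φ, hG⟩ := G.exists_isRoot
  exact hG.ancestry_eq ▸ SurjOp.isCirc_corel hG.surjective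

end Diagram

/-- The ancestry functor `Π`. -/
def ancestryHom : PROPHom Syn FinCorel where
  map := ancestry
  map_id n := Diagram.ancestry_ofEquiv (Equiv.refl (Fin n))
  map_comp f g := by
    induction f using Quotient.ind
    induction g using Quotient.ind
    exact Diagram.ancestry_comp _ _
  map_tensor f g := by
    induction f using Quotient.ind
    induction g using Quotient.ind
    exact Diagram.ancestry_tensor _ _
  map_symm m n := Diagram.ancestry_ofEquiv finAddFlip

theorem ancestryHom_delta : ancestryHom.map Syn.delta = SurjOp.toFinCorel.map SurjOp.delta := by
  obtain ⟨r, φ, h⟩ := Diagram.delta.exists_isRoot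
  exact h.ancestry_eq.trans
    (congrArg SurjOp.corel (funext fun _ => Subsingleton.elim (α := Fin 1) _ _))

theorem range_ancestryHom (m n : ℕ) :
    Set.range (ancestryHom.map : Syn.Hom m n → FinCorel.Hom m n) =
      {R : Corel m n | R.IsCirc} := by
  apply subset_antisymm
  · rintro _ ⟨f, rfl⟩
    induction f using Quotient.ind with
    | _ G => exact G.isCirc_ancestry
  · rw [← SurjOp.range_toFinCorel]
    rintro _ ⟨φ, rfl⟩
    obtain ⟨N, rfl⟩ := NormalForm.surjOp_eval_surjective φ
    refine ⟨N.eval Syn.delta, ?_⟩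
    simp only [PROPHom.map_normalForm_eval, ancestryHom_delta]

namespace Cocom

/-- Morphisms of `Cocom` are surjections. -/
noncomputable def isoSurjOp : PROPIso Cocom SurjOp :=
  .ofBijective toSurjOp fun _ _ => ⟨toSurjOp_injective, toSurjOp_surjective⟩

/-- Morphisms of `Cocom` are the corelations realised by diagrams. -/
noncomputable def isoRangeAncestryHom : PROPIso Cocom ancestryHom.range.toPROP :=
  isoSurjOp.trans <| .ofInjective SurjOp.toFinCorel SurjOp.toFinCorel_injective ancestryHom.range
    fun m n => (SurjOp.range_toFinCorel m n).trans (range_ancestryHom m n).symm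

end Cocom

end AncestryPROP

theorem mainTheorem1 :
    -- the ancestry assignment is a strict symmetric monoidal functor, identity on objects
    ∃ Pi : PROPHom Syn FinCorel,
      (∀ (m n : ℕ) (f : Syn.Hom m n), Pi.map f = ancestry f) ∧
      -- `FinCorel°` is a sub-PROP, and it is the image of the ancestry functor
      ∃ Circ : SubPROP FinCorel,
        (∀ (m n : ℕ) (R : Corel m n), R ∈ Circ.carrier m n ↔ R.IsCirc) ∧
        (∀ (m n : ℕ) (R : FinCorel.Hom m n),
          (∃ f : Syn.Hom m n, Pi.map f = R) ↔ R ∈ Circ.carrier m n) ∧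
        -- the induced functor on the quotient is an isomorphism onto `FinCorel°`
        (∃ Psi : PROPIso (kerQuot Pi) Circ.toPROP, ∀ (m n : ℕ) (f : Syn.Hom m n),
          (Psi.hom.map ((kerQuot.proj Pi).map f)).1 = Pi.map f) ∧
        -- the quotient is isomorphic to `Cocom`, generator to generator
        (∃ Phi : PROPIso Cocom (kerQuot Pi),
          Phi.hom.map Cocom.delta = (kerQuot.proj Pi).map Syn.delta) ∧
        -- morphisms `m → n` of `Cocom` are the surjections `{1, …, n} → {1, …, m}`
        (∃ Theta : PROPIso Cocom SurjOp, Theta.hom.map Cocom.delta = SurjOp.delta) := by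
  let Psi := kerQuot.isoRange ancestryHom
  have delta_eq : Cocom.isoRangeAncestryHom.hom.map Cocom.delta =
      Psi.hom.map ((kerQuot.proj ancestryHom).map Syn.delta) := Subtype.ext ancestryHom_delta.symm
  exact ⟨ancestryHom, fun _ _ _ => rfl,
    ancestryHom.range, fun m n R => iff_of_eq (congrArg (R ∈ ·) (range_ancestryHom m n)),
    fun _ _ _ => Iff.rfl,
    ⟨Psi, fun _ _ _ => rfl⟩,
    ⟨Cocom.isoRangeAncestryHom.trans Psi.symm,
      (congrArg Psi.inv.map delta_eq).trans (Psi.inv_hom _)⟩,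
    ⟨Cocom.isoSurjOp, Cocom.toSurjOp_delta⟩⟩
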